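/- Fix real numbers $\gamma_1>\gamma_2>1$ and $0<s<1/2$. For $k\ge 2$ and $p,q\in[0,1]$ let $\mathsf{SignedBlock}_k(p,q,s)$ be the following random signed graph on the vertex set $[n]$, $n=2k$, split into the communities $\{1,\dots,k\}$ and $\{k+1,\dots,2k\}$: independently for all pairs $\{i,j\}$ with $i\ne j$, the edge $\{i,j\}$ is present with probability $p$ if $i,j$ lie in the same community and with probability $q$ otherwise, and, independently of the edges, a negative sign is put on the pair with probability $s$ if $i,j$ lie in the same community and with probability $1-s$ otherwise (all other signs are positive). Let $A$ be the signed adjacency matrix ($a_{ij}=\pm1$ is the sign of the edge $\{i,j\}$ if it is present, and $a_{ij}=0$ otherwise), $D$ the diagonal matrix of the vertex degrees $d_i=\sum_j|a_{ij}|$, and $\mathcal L=D^{-1/2}(D-A)D^{-1/2}$ the normalized signed Laplacian, where $(D^{-1/2})_{ii}:=0$ if $d_i=0$. Denote its eigenvalues, counted with multiplicity, by $\lambda_1(\mathcal L)\le\lambda_2(\mathcal L)\le\dots\le\lambda_{2k}(\mathcal L)$. Then there exist constants $C_1,C_2,C_3>0$ and a sequence $(\varepsilon_k)$ with $\varepsilon_k\to0$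 as $k\to\infty$, all depending only on $\gamma_1,\gamma_2,s$, such that for every $k\ge2$ with $\gamma_1\log k/k\le1$, if $A\sim\mathsf{SignedBlock}_k(\gamma_1\log k/k,\ \gamma_2\log k/k,\ s)$, then with probability at least $1-C_1n^{-C_2}$, $n=2k$, the following estimates hold simultaneously: $$|\lambda_1(\mathcal L)-2s|\le C_3(\log k)^{-1/2},$$ $$\left|\lambda_2(\mathcal L)-\left(1-(1-2s)\frac{\gamma_1-\gamma_2}{\gamma_1+\gamma_2}\right)\right|\le\varepsilon_k,$$ $$|\lambda_\ell(\mathcal L)-1|\le\varepsilon_k\qquad\text{for all }2<\ell\le 2k.$$ -/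

import Mathlib

open MeasureTheory ProbabilityTheory

/-- A signed graph on the vertex set `V`: a simple graph together with a signature
`σ : E → {±1}` on its edges. -/
structure SignedGraph (V : Type*) where
  /-- the underlying (undirected, loopless) graph -/
  graph : SimpleGraph V
  /-- the signature -/
  sign : graph.edgeSet → ℤˣ

namespace SignedGraph

/-- On the finitely many signed graphs on `Fin n` every set is an event. -/
instance {V : Type*} : MeasurableSpace (SignedGraph V) := ⊤

variable {n : ℕ}

open Classical in
/-- The signed adjacency matrix `A`: `a i j = σ {i, j}` if `i ∼ j`, and `0` otherwise. -/
noncomputable def adjacency (G : SignedGraph (Fin n)) : Matrix (Fin n) (Fin n) ℝ :=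
  Matrix.of fun i j =>
    if h : G.graph.Adj i j then
      (((G.sign ⟨s(i, j), G.graph.mem_edgeSet.2 h⟩ : ℤˣ) : ℤ) : ℝ)
    else 0

/-- The degree of the vertex `i`: the number of edges at `i`, with either sign. -/
noncomputable def degree (G : SignedGraph (Fin n)) (i : Fin n) : ℕ :=
  (G.graph.neighborSet i).ncard

/-- The signed Laplacian matrix `L = D - A`. -/
noncomputable def laplacian (G : SignedGraph (Fin n)) : Matrix (Fin n) (Fin n) ℝ :=
  Matrix.diagonal (fun i => (G.degree i : ℝ)) - G.adjacency

/-- The diagonal matrix `D ^ (-1/2)`, whose entry at a vertex of degree `0` is `0`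
(as `0⁻¹ = 0`). -/
noncomputable def invSqrtDegree (G : SignedGraph (Fin n)) : Matrix (Fin n) (Fin n) ℝ :=
  Matrix.diagonal fun i => (Real.sqrt (G.degree i))⁻¹

/-- The normalized signed Laplacian matrix `D ^ (-1/2) * L * D ^ (-1/2)`. -/
noncomputable def normalizedLaplacian (G : SignedGraph (Fin n)) : Matrix (Fin n) (Fin n) ℝ :=
  G.invSqrtDegree * G.laplacian * G.invSqrtDegree

theorem adjacency_isHermitian (G : SignedGraph (Fin n)) : G.adjacency.IsHermitian := by
  ext i j
  simp only [Matrix.conjTranspose_apply, adjacency, Matrix.of_apply, star_trivial]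
  by_cases h : G.graph.Adj i j
  · have h2 : G.graph.Adj j i := h.symm
    rw [dif_pos h, dif_pos h2]
    congr 4
    exact Sym2.eq_swap
  · have h2 : ¬ G.graph.Adj j i := fun h3 => h h3.symm
    rw [dif_neg h, dif_neg h2]

theorem normalizedLaplacian_isHermitian (G : SignedGraph (Fin n)) :
    G.normalizedLaplacian.IsHermitian := by
  have hD : ∀ d : Fin n → ℝ, (Matrix.diagonal d).IsHermitian := fun d =>
    Matrix.isHermitian_diagonal d
  have hL : G.laplacian.IsHermitian := (hD _).sub G.adjacency_isHermitian
  have h := Matrix.isHermitian_conjTranspose_mul_mul G.invSqrtDegree hL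
  have hS : G.invSqrtDegree.IsHermitian := hD _
  rw [hS.eq] at h
  exact h

/-- The eigenvalues of the normalized signed Laplacian, with multiplicity, in ascending order:
`G.lapEigenvalue ℓ` is the `(ℓ + 1)`-st smallest one. (Mathlib's `eigenvalues₀` lists them in
descending order.) -/
noncomputable def lapEigenvalue (G : SignedGraph (Fin n)) (ℓ : Fin n) : ℝ :=
  G.normalizedLaplacian_isHermitian.eigenvalues₀ (Fin.cast (Fintype.card_fin n).symm ℓ.rev)

/-- The signed graph given by one pair of Booleans for each unordered pair `e` of distinct
vertices: the first one says whether `e` is an edge, the second one whether a negative sign is put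
on `e` (it is ignored if `e` is no edge). -/
def ofChoices (ω : {e : Sym2 (Fin n) // ¬ e.IsDiag} → Bool × Bool) : SignedGraph (Fin n) where
  graph :=
    { Adj := fun i j => ∃ h : ¬ (s(i, j) : Sym2 (Fin n)).IsDiag, (ω ⟨s(i, j), h⟩).1 = true
      symm := ⟨fun i j h => by rwa [Sym2.eq_swap]⟩
      loopless := ⟨fun i h => h.1 (Sym2.mk_isDiag_iff.2 rfl)⟩ }
  sign := fun e =>
    if (ω ⟨e.1, SimpleGraph.not_isDiag_of_mem_edgeSet _ e.2⟩).2 = true then -1 else 1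

end SignedGraph

/-- The signed inhomogeneous Erdős–Rényi model `G_n(P, S)` for symmetric matrices `P`, `S` of
probabilities: the law of the random signed graph on `Fin n` in which, independently for all
pairs `{i, j}` with `i ≠ j`, an edge is added with probability `P i j` and, independently, a
negative sign is put on it with probability `S i j`. (For `e = s(i, j)` the entry is read off
at `(min i j, max i j)`.) -/
noncomputable def signedErdosRenyi {n : ℕ} (P S : Matrix (Fin n) (Fin n) unitInterval) :
    Measure (SignedGraph (Fin n)) :=
  (Measure.pi fun e : {e : Sym2 (Fin n) // ¬ e.IsDiag} =>
    (bernoulliMeasure true false (P e.1.inf e.1.sup)).prod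
      (bernoulliMeasure true false (S e.1.inf e.1.sup))).map SignedGraph.ofChoices

/-- The extension of an `m × m` matrix of probabilities between clusters to a matrix indexed by
the vertices, where `c i` is the cluster of `i`; the diagonal is `0`. -/
def blockExtend {n m : ℕ} (c : Fin n → Fin m) (P : Matrix (Fin m) (Fin m) unitInterval) :
    Matrix (Fin n) (Fin n) unitInterval :=
  Matrix.of fun i j => if i = j then 0 else P (c i) (c j)

/-- The even bipartition of `2 * k` vertices into the first `k` and the last `k` ones. -/
def bisection (k : ℕ) (i : Fin (2 * k)) : Fin 2 :=
  if (i : ℕ) < k then 0 else 1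

/-- The signed stochastic bisection model `SignedBlock_k(p, q, s)`: edges appear with
probability `p` inside and `q` between the two communities, and negative signs with
probability `s` inside and `1 - s` between them. -/
noncomputable def signedBlock (k : ℕ) (p q s : unitInterval) :
    Measure (SignedGraph (Fin (2 * k))) :=
  signedErdosRenyi (blockExtend (bisection k) !![p, q; q, p])
    (blockExtend (bisection k) !![s, unitInterval.symm s; unitInterval.symm s, s])

/-! Put `y = D^(-1/2) x`. When no degree vanishes, the quadratic form of the normalized Laplacian at
`x` is `‖x‖² - yᵀ A y`. Off the diagonal, the mean of `A` is `a + b τᵢ τⱼ` with `τ` the sign vector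
of the bisection, `a = (1 - 2s)(p - q)/2` and `b = (1 - 2s)(p + q)/2`, while the typical degree is
`d = k(p + q)`. If `A` is close to its mean and `D` to `d`, the form is nearly that of the identity
minus an operator of rank two with eigenvalues `b n / d = 1 - 2s` and `a n / d = (1 - 2s)(γ₁ -
γ₂)/(γ₁ + γ₂)`. Courant-Fischer then locates all eigenvalues
(`LinearMap.IsSymmetric.eigenvalues_of_near_rank_two`).

Two probabilistic inputs suffice. All degrees are at least `log k / 10`, by a Chernoff bound and a
union bound. The signed and the unsigned adjacency matrix deviate from their block means by `O(√(log
k))` in operator norm (`exists_norm_edgeMatrix_tail`). The unsigned deviation, applied to the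
all-ones vector, also shows that the degrees are close to `d` in mean square, which is enough to
replace `D` by `d` in the rank one forms. Every error is then of order `√(log k) / log k`, so one
rate serves all the eigenvalues.

The norm bound uses trace moments of order about `log n`. The expected trace is a sum over closed
walks using every edge at least twice, and a walk with `m` vertices has weight at most `ρ^(m - 1)`.
Matching walks by their pattern of coincidences compares this sum with the trace moment of a dense
random matrix of size only `r = O(log n)`, whose entries take two values and have all moments of
order at least two bounded below by `1` (`integral_trace_pow_le_of_comparison`). A net of size `C^r`
and subgaussian tails control the small matrix; Markov's inequality concludes. -/

set_option linter.unusedSectionVars false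

/-! ### Courant-Fischer and perturbations of the identity minus a rank two operator. -/

section MinMax

open scoped InnerProductSpace

variable {E : Type*} [NormedAddCommGroup E] [InnerProductSpace ℝ E] [FiniteDimensional ℝ E]
  {T : E →ₗ[ℝ] E} {n : ℕ}

theorem LinearMap.IsSymmetric.inner_apply_self_eq_sum (hT : T.IsSymmetric)
    (hn : Module.finrank ℝ E = n) (x : E) :
    ⟪T x, x⟫_ℝ = ∑ i, hT.eigenvalues hn i * ⟪hT.eigenvectorBasis hn i, x⟫_ℝ ^ 2 := by
  rw [← (hT.eigenvectorBasis hn).sum_inner_mul_inner (T x) x]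
  refine Finset.sum_congr rfl fun i _ => ?_
  rw [hT x, hT.apply_eigenvectorBasis, inner_smul_right, real_inner_comm]
  simp
  ring_nf

omit [FiniteDimensional ℝ E] in
theorem exists_mem_ne_zero_forall_inner_eq_zero {ι : Type*} [Fintype ι] (W : Submodule ℝ E)
    (u : ι → E) (h : Fintype.card ι < Module.finrank ℝ W) :
    ∃ x ∈ W, x ≠ 0 ∧ ∀ i, ⟪u i, x⟫_ℝ = 0 := by
  let f : W →ₗ[ℝ] (ι → ℝ) := LinearMap.pi fun i => (innerSL ℝ (u i)).toLinearMap ∘ₗ W.subtype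
  have hf : ¬ Function.Injective f := fun hi => by
    have := LinearMap.finrank_le_finrank_of_injective hi
    rw [Module.finrank_fintype_fun_eq_card] at this
    omega
  rw [← LinearMap.ker_eq_bot, Submodule.eq_bot_iff] at hf
  push Not at hf
  obtain ⟨x, hx, hx0⟩ := hf
  refine ⟨x, x.2, by simpa using hx0, fun i => ?_⟩
  exact congrFun (LinearMap.mem_ker.1 hx) i

/-- One half of the Courant-Fischer principle. -/
theorem LinearMap.IsSymmetric.le_eigenvalues (hT : T.IsSymmetric)
    (hn : Module.finrank ℝ E = n) (W : Submodule ℝ E) (j : Fin n) {c : ℝ}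
    (hW : (j : ℕ) < Module.finrank ℝ W) (h : ∀ x ∈ W, c * ‖x‖ ^ 2 ≤ ⟪T x, x⟫_ℝ) :
    c ≤ hT.eigenvalues hn j := by
  obtain ⟨x, hxW, hx0, hx⟩ := exists_mem_ne_zero_forall_inner_eq_zero W
    (fun i : Fin j => hT.eigenvectorBasis hn (Fin.castLE j.2.le i)) (by simpa using hW)
  have h1 := h x hxW
  rw [hT.inner_apply_self_eq_sum hn] at h1
  have h2 : ∑ i, hT.eigenvalues hn i * ⟪hT.eigenvectorBasis hn i, x⟫_ℝ ^ 2
      ≤ ∑ i, hT.eigenvalues hn j * ⟪hT.eigenvectorBasis hn i, x⟫_ℝ ^ 2 := by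
    refine Finset.sum_le_sum fun i _ => ?_
    rcases lt_or_ge i j with hij | hij
    · have := hx ⟨i, hij⟩
      have h3 : Fin.castLE j.2.le ⟨i, hij⟩ = i := rfl
      rw [h3] at this
      simp [this]
    · exact mul_le_mul_of_nonneg_right (hT.eigenvalues_antitone hn hij) (sq_nonneg _)
  rw [← Finset.mul_sum, (hT.eigenvectorBasis hn).sum_sq_inner_right] at h2
  have h3 : 0 < ‖x‖ ^ 2 := by positivity
  exact le_of_mul_le_mul_right (h1.trans h2) h3

/-- The other half of the Courant-Fischer principle. -/
theorem LinearMap.IsSymmetric.eigenvalues_le (hT : T.IsSymmetric)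
    (hn : Module.finrank ℝ E = n) (W : Submodule ℝ E) (j : Fin n) {c : ℝ}
    (hW : n ≤ j + Module.finrank ℝ W) (h : ∀ x ∈ W, ⟪T x, x⟫_ℝ ≤ c * ‖x‖ ^ 2) :
    hT.eigenvalues hn j ≤ c := by
  obtain ⟨x, hxW, hx0, hx⟩ := exists_mem_ne_zero_forall_inner_eq_zero W
    (fun i : Finset.Ioi j => hT.eigenvectorBasis hn i) (by
      rw [Fintype.card_coe, Fin.card_Ioi]; omega)
  have h1 := h x hxW
  rw [hT.inner_apply_self_eq_sum hn] at h1
  have h2 : ∑ i, hT.eigenvalues hn j * ⟪hT.eigenvectorBasis hn i, x⟫_ℝ ^ 2 ≤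
      ∑ i, hT.eigenvalues hn i * ⟪hT.eigenvectorBasis hn i, x⟫_ℝ ^ 2 := by
    refine Finset.sum_le_sum fun i _ => ?_
    rcases lt_or_ge j i with hij | hij
    · have := hx ⟨i, Finset.mem_Ioi.2 hij⟩
      simp only at this
      simp [this]
    · exact mul_le_mul_of_nonneg_right (hT.eigenvalues_antitone hn hij) (sq_nonneg _)
  rw [← Finset.mul_sum, (hT.eigenvectorBasis hn).sum_sq_inner_right] at h2
  have h3 : 0 < ‖x‖ ^ 2 := by positivity
  exact le_of_mul_le_mul_right (h2.trans h1) h3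

/-- Eigenvalues of a symmetric operator whose quadratic form is close to that of the identity
minus an operator of rank two. -/
theorem LinearMap.IsSymmetric.eigenvalues_of_near_rank_two (hT : T.IsSymmetric)
    (hn : Module.finrank ℝ E = n) {v w : E} (hv : ‖v‖ = 1) (hw : ‖w‖ = 1) (hvw : ⟪v, w⟫_ℝ = 0)
    {α β δ : ℝ} (hα : 0 ≤ α) (hαβ : α ≤ β)
    (h : ∀ x, |⟪T x, x⟫_ℝ - (‖x‖ ^ 2 - α * ⟪w, x⟫_ℝ ^ 2 - β * ⟪v, x⟫_ℝ ^ 2)| ≤ δ * ‖x‖ ^ 2) :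
    (∀ j : Fin n, (j : ℕ) + 1 = n → |hT.eigenvalues hn j - (1 - β)| ≤ δ) ∧
    (∀ j : Fin n, (j : ℕ) + 2 = n → |hT.eigenvalues hn j - (1 - α)| ≤ δ) ∧
    (∀ j : Fin n, (j : ℕ) + 2 < n → |hT.eigenvalues hn j - 1| ≤ δ) := by
  have ho : Orthonormal ℝ ![v, w] := by
    rw [orthonormal_iff_ite]
    intro i j
    fin_cases i <;> fin_cases j <;> simp [hv, hw, hvw, real_inner_comm]
  have hbess : ∀ x, ⟪v, x⟫_ℝ ^ 2 + ⟪w, x⟫_ℝ ^ 2 ≤ ‖x‖ ^ 2 := fun x => by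
    simpa using ho.sum_inner_products_le x (s := Finset.univ)
  have hlo := fun x => (abs_le.1 (h x)).1
  have hhi := fun x => (abs_le.1 (h x)).2
  have hv1 : Module.finrank ℝ (ℝ ∙ v) = 1 := finrank_span_singleton (by
    rintro rfl; simp at hv)
  have hvw2 : Module.finrank ℝ (Submodule.span ℝ (Set.range ![v, w])) = 2 := by
    simpa using finrank_span_eq_card ho.linearIndependent
  have hspan : ∀ x ∈ Submodule.span ℝ (Set.range ![v, w]),
      ‖x‖ ^ 2 = ⟪v, x⟫_ℝ ^ 2 + ⟪w, x⟫_ℝ ^ 2 := by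
    intro x hx
    rw [Submodule.mem_span_range_iff_exists_fun] at hx
    obtain ⟨c, rfl⟩ := hx
    rw [Fin.sum_univ_two, norm_add_sq_real]
    simp [inner_add_right, inner_smul_left, inner_smul_right, norm_smul,
      hvw, hv, hw, real_inner_comm v w]
  have hcov : Module.finrank ℝ (ℝ ∙ v)ᗮ + 1 = n := by
    have := Submodule.finrank_add_finrank_orthogonal (ℝ ∙ v)
    omega
  have hcovw : Module.finrank ℝ (Submodule.span ℝ (Set.range ![v, w]))ᗮ + 2 = n := by
    have := Submodule.finrank_add_finrank_orthogonal (Submodule.span ℝ (Set.range ![v, w]))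
    omega
  have hov : ∀ x ∈ (ℝ ∙ v)ᗮ, ⟪v, x⟫_ℝ = 0 := fun x hx =>
    Submodule.mem_orthogonal_singleton_iff_inner_right.1 hx
  have hovw : ∀ x ∈ (Submodule.span ℝ (Set.range ![v, w]))ᗮ, ⟪v, x⟫_ℝ = 0 ∧ ⟪w, x⟫_ℝ = 0 :=
    fun x hx => ⟨(Submodule.mem_orthogonal _ _).1 hx _ (Submodule.subset_span ⟨0, rfl⟩),
      (Submodule.mem_orthogonal _ _).1 hx _ (Submodule.subset_span ⟨1, rfl⟩)⟩
  have htop : Module.finrank ℝ (⊤ : Submodule ℝ E) = n := by rw [finrank_top, hn]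
  -- Eigenvalues are listed in descending order, so `j + 1 = n` is the smallest one. The test spaces
  -- for the upper and lower bounds are `ℝ ∙ v` and everything; `span {v, w}` and the complement of
  -- `v`; everything and the complement of `span {v, w}`.
  refine ⟨fun j hj => ?_, fun j hj => ?_, fun j hj => ?_⟩
  · have h1 : hT.eigenvalues hn j ≤ 1 - β + δ := by
      refine hT.eigenvalues_le hn (ℝ ∙ v) j (by omega) fun x hx => ?_
      obtain ⟨c, rfl⟩ := Submodule.mem_span_singleton.1 hx
      have := hhi (c • v)
      simp [inner_smul_right, norm_smul, hv, real_inner_comm v w, hvw] at this ⊢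
      linarith
    have h2 : 1 - β - δ ≤ hT.eigenvalues hn j := by
      refine hT.le_eigenvalues hn ⊤ j (by omega) fun x _ => ?_
      nlinarith [hlo x, hbess x, sq_nonneg ⟪w, x⟫_ℝ, sq_nonneg ⟪v, x⟫_ℝ]
    rw [abs_le]; constructor <;> linarith
  · have h1 : hT.eigenvalues hn j ≤ 1 - α + δ := by
      refine hT.eigenvalues_le hn (Submodule.span ℝ (Set.range ![v, w])) j (by omega) fun x hx => ?_
      nlinarith [hhi x, hspan x hx, sq_nonneg ⟪w, x⟫_ℝ, sq_nonneg ⟪v, x⟫_ℝ]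
    have h2 : 1 - α - δ ≤ hT.eigenvalues hn j := by
      refine hT.le_eigenvalues hn (ℝ ∙ v)ᗮ j (by omega) fun x hx => ?_
      have h3 := hbess x
      have h4 := hlo x
      rw [hov x hx] at h3 h4
      nlinarith [sq_nonneg ⟪w, x⟫_ℝ]
    rw [abs_le]; constructor <;> linarith
  · have h1 : hT.eigenvalues hn j ≤ 1 + δ := by
      refine hT.eigenvalues_le hn ⊤ j (by omega) fun x _ => ?_
      nlinarith [hhi x, mul_nonneg hα (sq_nonneg ⟪w, x⟫_ℝ),
        mul_nonneg (hα.trans hαβ) (sq_nonneg ⟪v, x⟫_ℝ)]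
    have h2 : 1 - δ ≤ hT.eigenvalues hn j := by
      refine hT.le_eigenvalues hn (Submodule.span ℝ (Set.range ![v, w]))ᗮ j (by omega) fun x hx => ?_
      have h4 := hlo x
      rw [(hovw x hx).1, (hovw x hx).2] at h4
      linarith
    rw [abs_le]; constructor <;> linarith

end MinMax

/-! ### Trace moments as sums over closed walks. -/

section Walk

/-- The unordered pairs of distinct elements of `V`. -/
abbrev EdgeIndex (V : Type*) := {e : Sym2 V // ¬ e.IsDiag}

variable {V : Type*} [Fintype V] [DecidableEq V]

/-- The symmetric matrix with zero diagonal and off-diagonal entries `x`. -/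
def edgeMatrix (x : EdgeIndex V → ℝ) : Matrix V V ℝ :=
  Matrix.of fun i j => if h : (s(i, j) : Sym2 V).IsDiag then 0 else x ⟨s(i, j), h⟩

theorem edgeMatrix_isSymm (x : EdgeIndex V → ℝ) : (edgeMatrix x).IsSymm := by
  ext i j
  simp only [edgeMatrix, Matrix.transpose_apply, Matrix.of_apply, Sym2.eq_swap (a := j)]

theorem Matrix.pow_apply_eq_sum_walk (A : Matrix V V ℝ) (L : ℕ) (i j : V) :
    (A ^ L) i j = ∑ w : Fin (L + 1) → V,
      if w 0 = i ∧ w (Fin.last L) = j then ∏ t : Fin L, A (w t.castSucc) (w t.succ) else 0 := by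
  induction L generalizing i with
  | zero =>
    rw [← (Equiv.funUnique (Fin 1) V).symm.sum_comp]
    simp only [pow_zero, Matrix.one_apply, Finset.univ_eq_empty, Finset.prod_empty]
    by_cases h : i = j
    · subst h; simp
    · rw [if_neg h, Finset.sum_eq_zero]
      intro x _
      rw [if_neg]
      rintro ⟨h1, h2⟩
      exact h (h1.symm.trans h2)
  | succ L ih =>
    rw [pow_succ', Matrix.mul_apply]
    rw [← (Fin.consEquiv (fun _ : Fin (L + 2) => V)).sum_comp, Fintype.sum_prod_type]
    simp only [Fin.consEquiv_apply, Fin.cons_zero, Fin.prod_univ_succ, Fin.castSucc_zero,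
      Fin.cons_succ, ← Fin.succ_last, ← Fin.succ_castSucc]
    simp_rw [ih, Finset.mul_sum]
    rw [Finset.sum_comm, Finset.sum_comm (s := Finset.univ (α := V))]
    refine Finset.sum_congr rfl fun w _ => ?_
    rw [Finset.sum_eq_single (w 0) (fun k _ hk => by simp [hk.symm]) (by simp),
      Finset.sum_eq_single i (fun k _ hk => by simp [hk]) (by simp)]
    by_cases h : w (Fin.last L) = j <;> simp [h]

theorem Matrix.trace_pow_eq_sum_walk (A : Matrix V V ℝ) (L : ℕ) :
    (A ^ L).trace = ∑ w : Fin (L + 1) → V,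
      if w 0 = w (Fin.last L) then ∏ t : Fin L, A (w t.castSucc) (w t.succ) else 0 := by
  simp only [Matrix.trace, Matrix.diag_apply, Matrix.pow_apply_eq_sum_walk]
  rw [Finset.sum_comm]
  refine Finset.sum_congr rfl fun w _ => ?_
  rw [Finset.sum_eq_single (w 0) (fun k _ hk => by simp [hk.symm]) (by simp)]
  simp [eq_comm]

/-- The edge traversed by the walk `w` in its step `t`. -/
def walkEdge {L : ℕ} (w : Fin (L + 1) → V) (t : Fin L) : Sym2 V := s(w t.castSucc, w t.succ)

/-- A closed walk without loops that traverses each of its edges at least twice. -/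
def IsRepeatedWalk {L : ℕ} (w : Fin (L + 1) → V) : Prop :=
  w 0 = w (Fin.last L) ∧ (∀ t : Fin L, w t.castSucc ≠ w t.succ) ∧
    ∀ t : Fin L, ∃ t' ≠ t, walkEdge w t' = walkEdge w t

/-- A step to a vertex not seen before must use an edge not seen before, since an old edge has only
old endpoints. Induction along the walk adds at most one vertex per new edge. -/
theorem card_image_walk_le {L : ℕ} (w : Fin (L + 1) → V) :
    (Finset.univ.image w).card ≤ (Finset.univ.image (walkEdge w)).card + 1 := by
  have key : ∀ l : ℕ, l ≤ L → ((Finset.univ.filter fun a : Fin (L + 1) => (a : ℕ) ≤ l).image w).card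
      ≤ ((Finset.univ.filter fun t : Fin L => (t : ℕ) < l).image (walkEdge w)).card + 1 := by
    intro l
    induction l with
    | zero =>
      intro _
      have : (Finset.univ.filter fun a : Fin (L + 1) => (a : ℕ) ≤ 0) = {0} := by
        ext a; simp
      rw [this, Finset.image_singleton, Finset.card_singleton]
      omega
    | succ l ih =>
      intro hl
      have ih := ih (by omega)
      have h1 : (Finset.univ.filter fun a : Fin (L + 1) => (a : ℕ) ≤ l + 1) =
          insert ⟨l + 1, by omega⟩ (Finset.univ.filter fun a : Fin (L + 1) => (a : ℕ) ≤ l) := by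
        ext a
        simp only [Finset.mem_filter, Finset.mem_univ, true_and, Finset.mem_insert, Fin.ext_iff]
        omega
      have h2 : (Finset.univ.filter fun a : Fin L => (a : ℕ) < l + 1) =
          insert ⟨l, by omega⟩ (Finset.univ.filter fun a : Fin L => (a : ℕ) < l) := by
        ext a
        simp only [Finset.mem_filter, Finset.mem_univ, true_and, Finset.mem_insert, Fin.ext_iff]
        omega
      rw [h1, h2, Finset.image_insert, Finset.image_insert]
      by_cases hm : w ⟨l + 1, by omega⟩ ∈
          (Finset.univ.filter fun a : Fin (L + 1) => (a : ℕ) ≤ l).image w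
      · rw [Finset.insert_eq_of_mem hm]
        exact ih.trans (Nat.add_le_add_right (Finset.card_le_card (Finset.subset_insert _ _)) 1)
      · rw [Finset.card_insert_of_notMem hm, Finset.card_insert_of_notMem]
        · omega
        · intro he
          rw [Finset.mem_image] at he
          obtain ⟨t, ht, he⟩ := he
          have ht : (t : ℕ) < l := by simpa using ht
          have : w ⟨l + 1, by omega⟩ ∈ walkEdge w t := by
            rw [he]; exact Sym2.mem_mk_right _ _
          rcases Sym2.mem_iff.1 this with h | h <;> rw [h] at hm
          · exact hm (Finset.mem_image_of_mem _ (by simp; omega))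
          · exact hm (Finset.mem_image_of_mem _ (by simp; omega))
  have := key L le_rfl
  rwa [Finset.filter_true_of_mem (fun a _ => by omega),
    Finset.filter_true_of_mem (fun a _ => a.2)] at this

variable {Ω : Type*} [MeasurableSpace Ω] (μ : EdgeIndex V → Measure Ω)
  [∀ e, IsProbabilityMeasure (μ e)] (f : EdgeIndex V → Ω → ℝ)

theorem prod_edgeMatrix_of_loop {L : ℕ} (w : Fin (L + 1) → V) (x : EdgeIndex V → ℝ)
    (h : ¬ ∀ t : Fin L, w t.castSucc ≠ w t.succ) :
    ∏ t : Fin L, edgeMatrix x (w t.castSucc) (w t.succ) = 0 := by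
  push Not at h
  obtain ⟨t, ht⟩ := h
  exact Finset.prod_eq_zero (Finset.mem_univ t) (by simp [edgeMatrix, ht])

theorem prod_edgeMatrix {L : ℕ} (w : Fin (L + 1) → V) (x : EdgeIndex V → ℝ)
    (h : ∀ t : Fin L, w t.castSucc ≠ w t.succ) :
    ∏ t : Fin L, edgeMatrix x (w t.castSucc) (w t.succ) =
      ∏ e : EdgeIndex V, x e ^ (Finset.univ.filter fun t => walkEdge w t = e).card := by
  let g : Fin L → EdgeIndex V := fun t => ⟨walkEdge w t, by simpa [walkEdge] using h t⟩
  have h1 : ∀ t, edgeMatrix x (w t.castSucc) (w t.succ) = x (g t) := fun t => by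
    simp [edgeMatrix, h t, g, walkEdge]
  simp_rw [h1]
  rw [← Finset.prod_fiberwise' Finset.univ g x]
  refine Finset.prod_congr rfl fun e _ => ?_
  rw [Finset.prod_const]
  simp only [g, Subtype.ext_iff]

theorem integral_prod_edgeMatrix {L : ℕ} (w : Fin (L + 1) → V)
    (h : ∀ t : Fin L, w t.castSucc ≠ w t.succ) :
    ∫ ω, ∏ t : Fin L, edgeMatrix (fun e => f e (ω e)) (w t.castSucc) (w t.succ) ∂Measure.pi μ =
      ∏ e : EdgeIndex V,
        ∫ y, f e y ^ (Finset.univ.filter fun t => walkEdge w t = e).card ∂μ e := by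
  simp_rw [prod_edgeMatrix w _ h]
  exact integral_fintype_prod_eq_prod
    (fun (e : EdgeIndex V) y => f e y ^ (Finset.univ.filter fun t => walkEdge w t = e).card)

theorem IsRepeatedWalk.card_filter {L : ℕ} {w : Fin (L + 1) → V} (h : IsRepeatedWalk w)
    (e : Sym2 V) : (Finset.univ.filter fun t => walkEdge w t = e).card = 0 ∨
      2 ≤ (Finset.univ.filter fun t => walkEdge w t = e).card := by
  rw [or_iff_not_imp_left]
  intro h0
  obtain ⟨t, ht⟩ := Finset.card_ne_zero.1 h0
  obtain ⟨t', htt, ht'⟩ := h.2.2 t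
  have ht := (Finset.mem_filter.1 ht).2
  exact Finset.one_lt_card.2 ⟨t', Finset.mem_filter.2 ⟨Finset.mem_univ _, ht'.trans ht⟩, t,
    Finset.mem_filter.2 ⟨Finset.mem_univ _, ht⟩, htt⟩

variable {μ f}

/-- By independence the expectation factors over edges, and an edge traversed exactly once
contributes its mean. A loop meets the zero diagonal. -/
theorem integral_prod_eq_zero_of_not_isRepeatedWalk (hmean : ∀ e, ∫ y, f e y ∂μ e = 0) {L : ℕ}
    (w : Fin (L + 1) → V) (hcl : w 0 = w (Fin.last L)) (h : ¬ IsRepeatedWalk w) :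
    ∫ ω, ∏ t : Fin L, edgeMatrix (fun e => f e (ω e)) (w t.castSucc) (w t.succ) ∂Measure.pi μ
      = 0 := by
  by_cases hl : ∀ t : Fin L, w t.castSucc ≠ w t.succ
  · rw [integral_prod_edgeMatrix μ f w hl]
    have h2 : ¬ ∀ t : Fin L, ∃ t' ≠ t, walkEdge w t' = walkEdge w t := fun h3 => h ⟨hcl, hl, h3⟩
    push Not at h2
    obtain ⟨t, ht⟩ := h2
    refine Finset.prod_eq_zero (i := ⟨walkEdge w t, by simpa [walkEdge] using hl t⟩)
      (Finset.mem_univ _) ?_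
    have : (Finset.univ.filter fun t' => walkEdge w t' = walkEdge w t) = {t} := by
      ext t'
      simp only [Finset.mem_filter, Finset.mem_univ, true_and, Finset.mem_singleton]
      exact ⟨fun h => by_contra fun h' => ht t' h' h, fun h => by rw [h]⟩
    simp only [this, Finset.card_singleton, pow_one, hmean]
  · simp only [prod_edgeMatrix_of_loop w _ hl, integral_zero]

-- Every distinct edge of a repeated walk contributes a moment of order at least two, hence at most
-- `ρ`. There are at least as many edges as vertices minus one, and `ρ ≤ 1`.
open Classical in
theorem integral_prod_edgeMatrix_le {ρ : ℝ} (hρ0 : 0 ≤ ρ) (hρ1 : ρ ≤ 1)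
    (hmean : ∀ e, ∫ y, f e y ∂μ e = 0)
    (hmom : ∀ e (k : ℕ), 2 ≤ k → |∫ y, f e y ^ k ∂μ e| ≤ ρ) {L : ℕ}
    (w : Fin (L + 1) → V) (hcl : w 0 = w (Fin.last L)) :
    ∫ ω, ∏ t : Fin L, edgeMatrix (fun e => f e (ω e)) (w t.castSucc) (w t.succ) ∂Measure.pi μ
      ≤ if IsRepeatedWalk w then ρ ^ ((Finset.univ.image w).card - 1) else 0 := by
  split_ifs with h
  · rw [integral_prod_edgeMatrix μ f w h.2.1]
    refine (le_abs_self _).trans ?_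
    rw [Finset.abs_prod]
    have h1 : ∀ e : EdgeIndex V,
        |∫ y, f e y ^ (Finset.univ.filter fun t => walkEdge w t = e).card ∂μ e|
          ≤ if (e : Sym2 V) ∈ Finset.univ.image (walkEdge w) then ρ else 1 := by
      intro e
      rcases h.card_filter e with h0 | h2
      · simp only [h0, pow_zero, integral_const, probReal_univ, smul_eq_mul, mul_one, abs_one]
        rw [if_neg]
        intro he
        obtain ⟨t, _, ht⟩ := Finset.mem_image.1 he
        rw [Finset.card_eq_zero, Finset.filter_eq_empty_iff] at h0
        exact h0 (Finset.mem_univ t) ht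
      · rw [if_pos]
        · exact hmom e _ h2
        · obtain ⟨t, ht⟩ := Finset.card_pos.1 (by omega :
            0 < (Finset.univ.filter fun t => walkEdge w t = e).card)
          exact Finset.mem_image.2 ⟨t, Finset.mem_univ _, (Finset.mem_filter.1 ht).2⟩
    refine (Finset.prod_le_prod (fun _ _ => abs_nonneg _) fun e _ => h1 e).trans ?_
    rw [Finset.prod_ite, Finset.prod_const_one, mul_one, Finset.prod_const]
    refine pow_le_pow_of_le_one hρ0 hρ1 ?_
    have h3 : (Finset.univ.filter fun e : EdgeIndex V =>
        (e : Sym2 V) ∈ Finset.univ.image (walkEdge w)).card =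
        (Finset.univ.image (walkEdge w)).card := by
      rw [← Finset.card_map (Function.Embedding.subtype _)]
      congr 1
      ext e
      simp only [Finset.mem_map, Finset.mem_filter, Finset.mem_univ, true_and,
        Function.Embedding.coe_subtype, Subtype.exists, exists_and_left, exists_prop]
      constructor
      · rintro ⟨a, ha, _, rfl⟩; exact ha
      · intro he
        refine ⟨e, he, ?_, rfl⟩
        obtain ⟨t, _, rfl⟩ := Finset.mem_image.1 he
        simpa [walkEdge] using h.2.1 t
    rw [h3]
    have := card_image_walk_le w
    omega
  · exact (integral_prod_eq_zero_of_not_isRepeatedWalk hmean w hcl h).le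

open Classical in
theorem le_integral_prod_edgeMatrix (hmean : ∀ e, ∫ y, f e y ∂μ e = 0)
    (hmom : ∀ e (k : ℕ), 2 ≤ k → 1 ≤ ∫ y, f e y ^ k ∂μ e) {L : ℕ}
    (w : Fin (L + 1) → V) (hcl : w 0 = w (Fin.last L)) :
    (if IsRepeatedWalk w then (1 : ℝ) else 0) ≤
    ∫ ω, ∏ t : Fin L, edgeMatrix (fun e => f e (ω e)) (w t.castSucc) (w t.succ) ∂Measure.pi μ := by
  split_ifs with h
  · rw [integral_prod_edgeMatrix μ f w h.2.1]
    rw [← Finset.prod_const_one (s := Finset.univ (α := EdgeIndex V))]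
    refine Finset.prod_le_prod (fun _ _ => zero_le_one) fun e _ => ?_
    rcases h.card_filter e with h0 | h2
    · simp [h0]
    · exact hmom e _ h2
  · exact (integral_prod_eq_zero_of_not_isRepeatedWalk hmean w hcl h).ge

theorem integral_trace_pow_edgeMatrix (hf : ∀ e, Measurable (f e)) {b : ℝ}
    (hb : ∀ e y, |f e y| ≤ b) (L : ℕ) :
    ∫ ω, (edgeMatrix (fun e => f e (ω e)) ^ L).trace ∂Measure.pi μ =
      ∑ w : Fin (L + 1) → V, if w 0 = w (Fin.last L) then
        ∫ ω, ∏ t : Fin L, edgeMatrix (fun e => f e (ω e)) (w t.castSucc) (w t.succ) ∂Measure.pi μ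
        else 0 := by
  simp only [Matrix.trace_pow_eq_sum_walk]
  have hmeas : ∀ i j, Measurable fun ω : EdgeIndex V → Ω => edgeMatrix (fun e => f e (ω e)) i j := by
    intro i j
    simp only [edgeMatrix, Matrix.of_apply]
    split_ifs
    · exact measurable_const
    · exact (hf _).comp (measurable_pi_apply _)
  have hbd : ∀ i j (ω : EdgeIndex V → Ω), |edgeMatrix (fun e => f e (ω e)) i j| ≤ max b 0 := by
    intro i j ω
    simp only [edgeMatrix, Matrix.of_apply]
    split_ifs
    · simp
    · exact (hb _ _).trans (le_max_left _ _)
  rw [integral_finsetSum]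
  · refine Finset.sum_congr rfl fun w _ => ?_
    split_ifs <;> simp
  · intro w _
    split_ifs
    · refine Integrable.of_bound (C := ∏ _t : Fin L, max b 0) ?_ (Filter.Eventually.of_forall
        fun ω => ?_)
      · exact (Finset.measurable_prod _ fun t _ => hmeas _ _).aestronglyMeasurable
      · rw [Real.norm_eq_abs, Finset.abs_prod]
        exact Finset.prod_le_prod (fun _ _ => abs_nonneg _) fun t _ => hbd _ _ _
    · exact integrable_zero _ _ _

end Walk

/-! ### Comparison of trace moments across dimensions. -/

section Comparison

variable {V R : Type*} [Fintype V] [DecidableEq V] [Fintype R] [DecidableEq R]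

theorem IsRepeatedWalk.congr {L : ℕ} {w : Fin (L + 1) → V} {v : Fin (L + 1) → R}
    (h : ∀ a b, w a = w b ↔ v a = v b) : IsRepeatedWalk w ↔ IsRepeatedWalk v := by
  simp only [IsRepeatedWalk, walkEdge, Sym2.eq_iff, ne_eq, h]

theorem card_image_congr {A : Type*} [Fintype A] {w : A → V} {v : A → R}
    (h : ∀ a b, w a = w b ↔ v a = v b) :
    (Finset.univ.image w).card = (Finset.univ.image v).card := by
  refine Finset.card_bij' (fun x hx => v (Finset.mem_image.1 hx).choose)
    (fun y hy => w (Finset.mem_image.1 hy).choose) (fun _ _ => by simp) (fun _ _ => by simp) ?_ ?_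
  · intro x hx
    set a := (Finset.mem_image.1 hx).choose with ha
    have hax : w a = x := (Finset.mem_image.1 hx).choose_spec.2
    have hy : v a ∈ Finset.univ.image v := by simp
    have := (Finset.mem_image.1 hy).choose_spec.2
    rw [← h, hax] at this
    exact this
  · intro y hy
    set a := (Finset.mem_image.1 hy).choose with ha
    have hay : v a = y := (Finset.mem_image.1 hy).choose_spec.2
    have hx : w a ∈ Finset.univ.image w := by simp
    have := (Finset.mem_image.1 hx).choose_spec.2
    rw [h, hay] at this
    exact this

/-- The number of maps with the same fibres as a given one. -/
theorem card_filter_same_kernel {A : Type*} [Fintype A] [DecidableEq A] (w : A → V)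
    [DecidablePred fun v : A → R => ∀ a b, w a = w b ↔ v a = v b] :
    (Finset.univ.filter fun v : A → R => ∀ a b, w a = w b ↔ v a = v b).card =
      (Fintype.card R).descFactorial (Finset.univ.image w).card := by
  rw [← Fintype.card_coe (Finset.univ.image w), ← Fintype.card_embedding_eq, ← Fintype.card_subtype]
  refine Fintype.card_congr
    { toFun := fun v => ⟨fun x => v.1 (Finset.mem_image.1 x.2).choose, fun x y hxy => ?_⟩
      invFun := fun g => ⟨fun a => g ⟨w a, by simp⟩, fun a b => by simp⟩
      left_inv := fun v => ?_
      right_inv := fun g => ?_ }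
  · have := (v.2 _ _).2 hxy
    rw [(Finset.mem_image.1 x.2).choose_spec.2, (Finset.mem_image.1 y.2).choose_spec.2] at this
    exact Subtype.ext this
  · ext a
    have hx : w a ∈ Finset.univ.image w := by simp
    exact (v.2 _ _).1 (Finset.mem_image.1 hx).choose_spec.2
  · refine Function.Embedding.ext fun x => ?_
    exact congrArg g (Subtype.ext (Finset.mem_image.1 x.2).choose_spec.2)

/-- The left falling factorial is at most `n ^ m`. After its leading factor `r`, the right one has
`m - 1` factors, each at least `r - L ≥ n ρ`. -/
theorem descFactorial_ratio_le {n r L m : ℕ} {ρ : ℝ} (hρ0 : 0 ≤ ρ) (hm : 1 ≤ m) (hmL : m ≤ L + 1)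
    (hr : n * ρ + L ≤ r) (hLr : L < r) :
    r * ((n.descFactorial m : ℝ) * ρ ^ (m - 1)) ≤ n * (r.descFactorial m : ℝ) := by
  obtain ⟨k, rfl⟩ : ∃ k, m = k + 1 := ⟨m - 1, by omega⟩
  obtain ⟨r', rfl⟩ : ∃ k, r = k + 1 := ⟨r - 1, by omega⟩
  have h1 : ((n.descFactorial (k + 1) : ℕ) : ℝ) ≤ (n : ℝ) ^ (k + 1) := by
    exact_mod_cast Nat.descFactorial_le_pow n (k + 1)
  have h2 : ((r' + 1 - k : ℕ) : ℝ) ^ k ≤ (r'.descFactorial k : ℝ) := by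
    exact_mod_cast Nat.pow_sub_le_descFactorial r' k
  have h3 : (n * ρ : ℝ) ≤ ((r' + 1 - k : ℕ) : ℝ) := by
    rw [Nat.cast_sub (by omega)]
    have : (k : ℝ) ≤ L := by exact_mod_cast (by omega : k ≤ L)
    linarith
  have h4 : (n * ρ : ℝ) ^ k ≤ (r'.descFactorial k : ℝ) :=
    (pow_le_pow_left₀ (by positivity) h3 k).trans h2
  rw [Nat.succ_descFactorial_succ, Nat.add_sub_cancel, Nat.cast_mul]
  calc ((r' + 1 : ℕ) : ℝ) * ((n.descFactorial (k + 1) : ℝ) * ρ ^ k)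
      ≤ ((r' + 1 : ℕ) : ℝ) * ((n : ℝ) ^ (k + 1) * ρ ^ k) := by gcongr
    _ = n * (((r' + 1 : ℕ) : ℝ) * (n * ρ : ℝ) ^ k) := by rw [mul_pow]; ring
    _ ≤ _ := by gcongr

-- Being repeated and the number of vertices depend only on which times of the walk coincide. A
-- pattern with `m` vertices is realised `n.descFactorial m` times in `V` and `r.descFactorial m`
-- times in `R`, so the claim reduces to `descFactorial_ratio_le` pattern by pattern.
open Classical in
theorem sum_isRepeatedWalk_le (L : ℕ) {ρ : ℝ} (hρ0 : 0 ≤ ρ)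
    (hr : Fintype.card V * ρ + L ≤ Fintype.card R) (hLr : L < Fintype.card R) :
    Fintype.card R * ∑ w : Fin (L + 1) → V,
        (if IsRepeatedWalk w then ρ ^ ((Finset.univ.image w).card - 1) else 0) ≤
      Fintype.card V * ∑ v : Fin (L + 1) → R, if IsRepeatedWalk v then (1 : ℝ) else 0 := by
  set n := Fintype.card V
  set r := Fintype.card R
  have himg : ∀ {U : Type _} [DecidableEq U] (w : Fin (L + 1) → U),
      1 ≤ (Finset.univ.image w).card ∧ (Finset.univ.image w).card ≤ L + 1 := fun w =>
    ⟨Finset.card_pos.2 ⟨w 0, by simp⟩, by simpa using Finset.card_image_le (s := Finset.univ) (f := w)⟩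
  have himg' : ∀ (w : Fin (L + 1) → R),
      1 ≤ (Finset.univ.image w).card ∧ (Finset.univ.image w).card ≤ L + 1 := fun w =>
    ⟨Finset.card_pos.2 ⟨w 0, by simp⟩, by simpa using Finset.card_image_le (s := Finset.univ) (f := w)⟩
  have hpos : ∀ m : ℕ, m ≤ L + 1 → (0 : ℝ) < r.descFactorial m := fun m hm => by
    exact_mod_cast Nat.pos_of_ne_zero (by rw [Ne, Nat.descFactorial_eq_zero_iff_lt]; omega)
  -- The weight of `w` is spread evenly over the walks in `R` with the same pattern. Their number is
  -- nonzero because `m ≤ L + 1 ≤ r`.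
  have h1 : ∀ w : Fin (L + 1) → V,
      (if IsRepeatedWalk w then ρ ^ ((Finset.univ.image w).card - 1) else 0) =
      ∑ v : Fin (L + 1) → R, if ∀ a b, w a = w b ↔ v a = v b then
        (if IsRepeatedWalk v then ρ ^ ((Finset.univ.image v).card - 1) /
          r.descFactorial (Finset.univ.image v).card else 0) else 0 := by
    intro w
    have h2 : ∀ v : Fin (L + 1) → R, (if ∀ a b, w a = w b ↔ v a = v b then
        (if IsRepeatedWalk v then ρ ^ ((Finset.univ.image v).card - 1) /
          r.descFactorial (Finset.univ.image v).card else 0) else 0) =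
        if ∀ a b, w a = w b ↔ v a = v b then
        (if IsRepeatedWalk w then ρ ^ ((Finset.univ.image w).card - 1) /
          r.descFactorial (Finset.univ.image w).card else 0) else 0 := by
      intro v
      by_cases h : ∀ a b, w a = w b ↔ v a = v b
      · rw [if_pos h, if_pos h, card_image_congr h, IsRepeatedWalk.congr h]
      · rw [if_neg h, if_neg h]
    simp_rw [h2]
    rw [← Finset.sum_filter, Finset.sum_const, card_filter_same_kernel, nsmul_eq_mul]
    split_ifs
    · have := hpos _ (himg w).2
      field_simp
      rfl
    · simp
  simp_rw [h1]
  rw [Finset.sum_comm, Finset.mul_sum, Finset.mul_sum]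
  refine Finset.sum_le_sum fun v _ => ?_
  rw [← Finset.sum_filter, Finset.sum_const]
  have h3 : (Finset.univ.filter fun w : Fin (L + 1) → V => ∀ a b, w a = w b ↔ v a = v b) =
      Finset.univ.filter fun w : Fin (L + 1) → V => ∀ a b, v a = v b ↔ w a = w b := by
    ext w
    simp only [Finset.mem_filter, Finset.mem_univ, true_and]
    exact forall₂_congr fun a b => iff_comm
  rw [h3, card_filter_same_kernel, nsmul_eq_mul]
  split_ifs
  · have hp := hpos _ (himg' v).2
    rw [mul_div_assoc', mul_div_assoc', div_le_iff₀ hp, mul_one]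
    exact descFactorial_ratio_le hρ0 (himg' v).1 (himg' v).2 hr hLr
  · simp

/-- Comparison of the trace moments of two random symmetric matrices of different size. -/
theorem integral_trace_pow_le_of_comparison {Ω Ω' : Type*} [MeasurableSpace Ω] [MeasurableSpace Ω']
    {μ : EdgeIndex V → Measure Ω} [∀ e, IsProbabilityMeasure (μ e)] {f : EdgeIndex V → Ω → ℝ}
    {ν : EdgeIndex R → Measure Ω'} [∀ e, IsProbabilityMeasure (ν e)] {g : EdgeIndex R → Ω' → ℝ}
    (hf : ∀ e, Measurable (f e)) {b : ℝ} (hb : ∀ e y, |f e y| ≤ b)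
    (hg : ∀ e, Measurable (g e)) {b' : ℝ} (hb' : ∀ e y, |g e y| ≤ b')
    {ρ : ℝ} (hρ0 : 0 ≤ ρ) (hρ1 : ρ ≤ 1)
    (hfmean : ∀ e, ∫ y, f e y ∂μ e = 0)
    (hfmom : ∀ e (k : ℕ), 2 ≤ k → |∫ y, f e y ^ k ∂μ e| ≤ ρ)
    (hgmean : ∀ e, ∫ y, g e y ∂ν e = 0)
    (hgmom : ∀ e (k : ℕ), 2 ≤ k → 1 ≤ ∫ y, g e y ^ k ∂ν e) (L : ℕ)
    (hr : Fintype.card V * ρ + L ≤ Fintype.card R) (hLr : L < Fintype.card R) :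
    Fintype.card R * ∫ ω, (edgeMatrix (fun e => f e (ω e)) ^ L).trace ∂Measure.pi μ ≤
      Fintype.card V * ∫ ω, (edgeMatrix (fun e => g e (ω e)) ^ L).trace ∂Measure.pi ν := by
  classical
  rw [integral_trace_pow_edgeMatrix hf hb, integral_trace_pow_edgeMatrix hg hb']
  refine le_trans ?_ ((sum_isRepeatedWalk_le (V := V) (R := R) L hρ0 hr hLr).trans ?_)
  · gcongr with w
    split_ifs with h1 h2 h2
    · simpa [h2] using integral_prod_edgeMatrix_le hρ0 hρ1 hfmean hfmom w h1
    · simpa [h2] using integral_prod_edgeMatrix_le hρ0 hρ1 hfmean hfmom w h1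
    · positivity
    · exact le_rfl
  · gcongr with v
    split_ifs with h1 h2 h2
    · simpa [h1] using le_integral_prod_edgeMatrix hgmean hgmom v h2
    · exact absurd h1.1 h2
    · simpa [h1] using le_integral_prod_edgeMatrix hgmean hgmom v h2
    · exact le_rfl

end Comparison

/-! ### Subgaussian moments of a quadratic form. -/

section Net

variable {R : Type*} [Fintype R] [DecidableEq R]

theorem sum_sum_edge (F : Sym2 R → ℝ) :
    ∑ i, ∑ j, (if (s(i, j) : Sym2 R).IsDiag then 0 else F s(i, j)) =
      2 * ∑ e : EdgeIndex R, F e := by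
  have h1 : ∑ e : EdgeIndex R, F e = ∑ e : Sym2 R, if e.IsDiag then 0 else F e := by
    rw [← Finset.sum_filter_add_sum_filter_not Finset.univ (fun e : Sym2 R => ¬ e.IsDiag)
      (fun e : Sym2 R => if e.IsDiag then 0 else F e)]
    rw [Finset.sum_eq_zero (s := Finset.univ.filter fun e : Sym2 R => ¬ ¬ e.IsDiag), add_zero]
    · rw [← Finset.sum_subtype_eq_sum_filter, Finset.subtype_univ]
      exact Finset.sum_congr rfl fun e _ => (if_neg e.2).symm
    · intro e he
      simp only [not_not, Finset.mem_filter] at he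
      rw [if_pos he.2]
  rw [h1, ← Fintype.sum_prod_type', Finset.mul_sum,
    ← Finset.sum_fiberwise' Finset.univ (fun p : R × R => (s(p.1, p.2) : Sym2 R))
      (fun e => if e.IsDiag then 0 else F e)]
  refine Finset.sum_congr rfl fun e _ => ?_
  rw [Finset.sum_const, nsmul_eq_mul]
  by_cases he : e.IsDiag
  · simp [he]
  · induction e with
    | _ a b =>
      have hab : a ≠ b := by simpa using he
      have : (Finset.univ.filter fun p : R × R => (s(p.1, p.2) : Sym2 R) = s(a, b)) =
          {(a, b), (b, a)} := by
        ext ⟨c, d⟩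
        simp
      rw [this, Finset.card_pair (by simp [hab])]
      norm_num

open scoped Matrix in
theorem dotProduct_edgeMatrix_mulVec (y : EdgeIndex R → ℝ) (z : R → ℝ) :
    z ⬝ᵥ edgeMatrix y *ᵥ z = ∑ e : EdgeIndex R, 2 * ((e : Sym2 R).map z).mul * y e := by
  have h := sum_sum_edge (R := R) (fun e => (e.map z).mul * if h : e.IsDiag then 0 else y ⟨e, h⟩)
  have h2 : ∑ e : EdgeIndex R, 2 * ((e : Sym2 R).map z).mul * y e =
      2 * ∑ e : EdgeIndex R, ((e : Sym2 R).map z).mul *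
        (if h : (e : Sym2 R).IsDiag then 0 else y ⟨e, h⟩) := by
    rw [Finset.mul_sum]
    refine Finset.sum_congr rfl fun e _ => ?_
    rw [dif_neg e.2, mul_assoc]
  rw [h2, ← h]
  simp only [dotProduct, Matrix.mulVec, edgeMatrix, Matrix.of_apply, Finset.mul_sum]
  refine Finset.sum_congr rfl fun i _ => Finset.sum_congr rfl fun j _ => ?_
  split_ifs
  · simp
  · simp only [Sym2.map_mk, Sym2.mul_mk]; ring

theorem sum_edge_mul_sq_le (z : R → ℝ) :
    ∑ e : EdgeIndex R, (2 * ((e : Sym2 R).map z).mul) ^ 2 ≤ 2 * (z ⬝ᵥ z) ^ 2 := by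
  have h := sum_sum_edge (R := R) (fun e => (e.map z).mul ^ 2)
  have h2 : ∑ i, ∑ j, (if (s(i, j) : Sym2 R).IsDiag then 0 else ((s(i, j) : Sym2 R).map z).mul ^ 2)
      ≤ ∑ i, ∑ j, (z i * z i) * (z j * z j) := by
    refine Finset.sum_le_sum fun i _ => Finset.sum_le_sum fun j _ => ?_
    split_ifs
    · exact mul_nonneg (mul_self_nonneg _) (mul_self_nonneg _)
    · simp only [Sym2.map_mk, Sym2.mul_mk]; ring_nf; exact le_rfl
  rw [← Finset.sum_mul_sum] at h2
  simp only [mul_pow, ← Finset.mul_sum]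
  simp only [dotProduct]
  nlinarith

-- The form is a sum of independent centred terms, one per edge. Hoeffding's lemma bounds each
-- factor, and the squared coefficients sum to at most `2 (z ⬝ᵥ z)²`.
open scoped Matrix in
theorem integral_exp_edgeMatrix_le {Ω : Type*} [MeasurableSpace Ω] (μ : EdgeIndex R → Measure Ω)
    [∀ e, IsProbabilityMeasure (μ e)] (g : EdgeIndex R → Ω → ℝ) (hg : ∀ e, Measurable (g e)) {b : ℝ}
    (hb0 : 0 ≤ b) (hb : ∀ e y, |g e y| ≤ b) (hmean : ∀ e, ∫ y, g e y ∂μ e = 0) (t : ℝ) (z : R → ℝ) :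
    ∫ ω, Real.exp (t * (z ⬝ᵥ edgeMatrix (fun e => g e (ω e)) *ᵥ z)) ∂Measure.pi μ ≤
      Real.exp (b ^ 2 * t ^ 2 * (z ⬝ᵥ z) ^ 2) := by
  have h1 : ∀ ω : EdgeIndex R → Ω,
      Real.exp (t * (z ⬝ᵥ edgeMatrix (fun e => g e (ω e)) *ᵥ z)) =
      ∏ e : EdgeIndex R, Real.exp ((t * (2 * ((e : Sym2 R).map z).mul)) * g e (ω e)) := fun ω => by
    rw [dotProduct_edgeMatrix_mulVec, Finset.mul_sum, Real.exp_sum]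
    exact Finset.prod_congr rfl fun e _ => by ring_nf
  simp_rw [h1]
  rw [integral_fintype_prod_eq_prod
    (fun (e : EdgeIndex R) y => Real.exp ((t * (2 * ((e : Sym2 R).map z).mul)) * g e y))]
  have h2 : ∀ e : EdgeIndex R, ∫ y, Real.exp ((t * (2 * ((e : Sym2 R).map z).mul)) * g e y) ∂μ e ≤
      Real.exp (b ^ 2 * (t * (2 * ((e : Sym2 R).map z).mul)) ^ 2 / 2) := fun e => by
    have := (hasSubgaussianMGF_of_mem_Icc_of_integral_eq_zero (hg e).aemeasurable
      (Filter.Eventually.of_forall fun y => abs_le.1 (hb e y)) (hmean e)).mgf_le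
        (t * (2 * ((e : Sym2 R).map z).mul))
    refine this.trans (le_of_eq ?_)
    congr 3
    simp only [sub_neg_eq_add, NNReal.coe_pow, NNReal.coe_div, coe_nnnorm, Real.norm_eq_abs,
      NNReal.coe_ofNat]
    rw [abs_of_nonneg (by positivity)]
    ring
  refine (Finset.prod_le_prod (fun e _ => integral_nonneg fun y => (Real.exp_pos _).le)
    fun e _ => h2 e).trans ?_
  rw [← Real.exp_sum, Real.exp_le_exp]
  have h3 := mul_le_mul_of_nonneg_left (sum_edge_mul_sq_le z) (by positivity : 0 ≤ b ^ 2 * t ^ 2 / 2)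
  rw [Finset.mul_sum] at h3
  refine (Finset.sum_le_sum fun e _ => le_of_eq ?_).trans (h3.trans (le_of_eq ?_)) <;> ring

theorem pow_le_exp_add_exp (x t : ℝ) (ht : 0 < t) (m : ℕ) :
    x ^ (2 * m) ≤ (2 * m).factorial / t ^ (2 * m) * (Real.exp (t * x) + Real.exp (-t * x)) := by
  have h1 := Real.pow_div_factorial_le_exp |t * x| (abs_nonneg _) (2 * m)
  have h2 : Real.exp |t * x| ≤ Real.exp (t * x) + Real.exp (-t * x) := by
    rcases abs_cases (t * x) with ⟨h, _⟩ | ⟨h, _⟩ <;> rw [h]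
    · linarith [Real.exp_pos (-t * x)]
    · rw [neg_mul]; linarith [Real.exp_pos (t * x)]
  rw [pow_mul, sq_abs, ← pow_mul, mul_pow, div_le_iff₀ (by positivity)] at h1
  rw [div_mul_eq_mul_div, le_div_iff₀ (by positivity)]
  have : (0 : ℝ) ≤ (2 * m).factorial := by positivity
  nlinarith

open scoped Matrix in
theorem integral_quadratic_pow_le {Ω : Type*} [MeasurableSpace Ω] (μ : EdgeIndex R → Measure Ω)
    [∀ e, IsProbabilityMeasure (μ e)] (g : EdgeIndex R → Ω → ℝ) (hg : ∀ e, Measurable (g e)) {b : ℝ}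
    (hb0 : 0 ≤ b) (hb : ∀ e y, |g e y| ≤ b) (hmean : ∀ e, ∫ y, g e y ∂μ e = 0) (z : R → ℝ)
    (hz : z ⬝ᵥ z ≤ 2) {m : ℕ} (hm : 0 < m) :
    ∫ ω, (z ⬝ᵥ edgeMatrix (fun e => g e (ω e)) *ᵥ z) ^ (2 * m) ∂Measure.pi μ ≤
      2 * (4 * Real.exp (4 * b ^ 2) * m) ^ m := by
  -- With `t² = m` the exponential moment is `exp (O(m))` and the prefactor `(2m)! / t^(2m)` is at
  -- most `(4m)^m`, so both have the required form of an `m`-th power.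
  set t := Real.sqrt m with ht
  have ht0 : 0 < t := Real.sqrt_pos.2 (by exact_mod_cast hm)
  have ht2 : t ^ 2 = m := Real.sq_sqrt (by positivity)
  have hmeas : Measurable fun ω : EdgeIndex R → Ω =>
      z ⬝ᵥ edgeMatrix (fun e => g e (ω e)) *ᵥ z := by
    simp_rw [dotProduct_edgeMatrix_mulVec]
    exact Finset.measurable_sum _ fun e _ => ((hg e).comp (measurable_pi_apply e)).const_mul _
  have hint : ∀ u : ℝ, Integrable (fun ω : EdgeIndex R → Ω =>
      Real.exp (u * (z ⬝ᵥ edgeMatrix (fun e => g e (ω e)) *ᵥ z))) (Measure.pi μ) := by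
    intro u
    refine Integrable.of_bound
      (C := Real.exp (∑ e : EdgeIndex R, |u| * (|2 * ((e : Sym2 R).map z).mul| * b)))
      (hmeas.const_mul u).exp.aestronglyMeasurable (Filter.Eventually.of_forall fun ω => ?_)
    rw [Real.norm_eq_abs, Real.abs_exp, Real.exp_le_exp, dotProduct_edgeMatrix_mulVec,
      Finset.mul_sum]
    refine Finset.sum_le_sum fun e _ => (le_abs_self _).trans ?_
    rw [abs_mul, abs_mul]
    gcongr
    exact hb _ _
  have hq0 : 0 ≤ z ⬝ᵥ z := Finset.sum_nonneg fun i _ => mul_self_nonneg _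
  have hexp : ∀ u : ℝ, u ^ 2 = m → ∫ ω, Real.exp (u * (z ⬝ᵥ edgeMatrix (fun e => g e (ω e)) *ᵥ z))
      ∂Measure.pi μ ≤ Real.exp (4 * b ^ 2 * m) := fun u hu => by
    refine (integral_exp_edgeMatrix_le μ g hg hb0 hb hmean u z).trans (Real.exp_le_exp.2 ?_)
    rw [hu]
    have : (z ⬝ᵥ z) ^ 2 ≤ 4 := by nlinarith
    calc b ^ 2 * m * (z ⬝ᵥ z) ^ 2 ≤ b ^ 2 * m * 4 := by gcongr
      _ = _ := by ring
  calc ∫ ω, (z ⬝ᵥ edgeMatrix (fun e => g e (ω e)) *ᵥ z) ^ (2 * m) ∂Measure.pi μ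
      ≤ ∫ ω, (2 * m).factorial / t ^ (2 * m) *
        (Real.exp (t * (z ⬝ᵥ edgeMatrix (fun e => g e (ω e)) *ᵥ z)) +
          Real.exp (-t * (z ⬝ᵥ edgeMatrix (fun e => g e (ω e)) *ᵥ z))) ∂Measure.pi μ := by
        refine integral_mono_of_nonneg (Filter.Eventually.of_forall fun ω => ?_)
          (((hint t).add (hint (-t))).const_mul _) (Filter.Eventually.of_forall fun ω => ?_)
        · exact (even_two_mul m).pow_nonneg _
        · exact pow_le_exp_add_exp _ t ht0 m
    _ = (2 * m).factorial / t ^ (2 * m) *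
        (∫ ω, Real.exp (t * (z ⬝ᵥ edgeMatrix (fun e => g e (ω e)) *ᵥ z)) ∂Measure.pi μ +
          ∫ ω, Real.exp (-t * (z ⬝ᵥ edgeMatrix (fun e => g e (ω e)) *ᵥ z)) ∂Measure.pi μ) := by
        rw [integral_const_mul, integral_add (hint t) (hint (-t))]
    _ ≤ (2 * m : ℝ) ^ (2 * m) / t ^ (2 * m) *
        (Real.exp (4 * b ^ 2 * m) + Real.exp (4 * b ^ 2 * m)) := by
        gcongr
        · exact_mod_cast Nat.factorial_le_pow (2 * m)
        · exact hexp t ht2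
        · exact hexp (-t) (by rw [neg_sq, ht2])
    _ = 2 * (4 * Real.exp (4 * b ^ 2) * m) ^ m := by
        have hm0 : (m : ℝ) ≠ 0 := by positivity
        rw [mul_comm (4 * b ^ 2), Real.exp_nat_mul, pow_mul t, ht2, pow_mul (2 * m : ℝ)]
        rw [← div_pow, ← two_mul, mul_left_comm, ← mul_pow]
        congr 2
        field_simp
        ring

end Net

/-! ### Nets of the sphere from a scaled integer lattice. -/

section LatticeNet

theorem summable_exp_neg_int_sq : Summable fun k : ℤ => Real.exp (-(k : ℝ) ^ 2) := by
  have h : Summable fun k : ℕ => Real.exp (-(k : ℝ) ^ 2) := by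
    refine Summable.of_nonneg_of_le (fun _ => (Real.exp_pos _).le) (fun k => ?_)
      Real.summable_exp_neg_nat
    rw [Real.exp_le_exp]
    have : (k : ℝ) ≤ (k : ℝ) ^ 2 := by exact_mod_cast Nat.le_self_pow two_ne_zero k
    linarith
  refine Summable.of_nat_of_neg ?_ ?_
  · simpa using h
  · simpa using h

variable {R : Type*} [Fintype R] [DecidableEq R]

-- Counting by an exponential weight: each point of the ball has weight `exp (21 r - ∑ kᵢ²) ≥ 1`,
-- and over the whole box the weights factor over the coordinates.
open Classical in
theorem card_lattice_ball_le :
    ((Fintype.piFinset fun _ : R => Finset.Icc (-(21 * Fintype.card R : ℤ)) (21 * Fintype.card R)).filter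
      fun k => ∑ i, (k i : ℝ) ^ 2 ≤ 21 * Fintype.card R).card ≤
      (Real.exp 21 * ∑' k : ℤ, Real.exp (-(k : ℝ) ^ 2)) ^ Fintype.card R := by
  set r := Fintype.card R with hr
  set B := Finset.Icc (-(21 * r : ℤ)) (21 * r)
  calc ((((Fintype.piFinset fun _ : R => B).filter
          fun k => ∑ i, (k i : ℝ) ^ 2 ≤ 21 * r).card : ℕ) : ℝ)
      = ∑ k ∈ (Fintype.piFinset fun _ : R => B).filter fun k => ∑ i, (k i : ℝ) ^ 2 ≤ 21 * r,
          (1 : ℝ) := by simp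
    _ ≤ ∑ k ∈ (Fintype.piFinset fun _ : R => B).filter fun k => ∑ i, (k i : ℝ) ^ 2 ≤ 21 * r,
          Real.exp (21 * r - ∑ i, (k i : ℝ) ^ 2) := by
        refine Finset.sum_le_sum fun k hk => Real.one_le_exp ?_
        linarith [(Finset.mem_filter.1 hk).2]
    _ ≤ ∑ k ∈ Fintype.piFinset fun _ : R => B, Real.exp (21 * r - ∑ i, (k i : ℝ) ^ 2) :=
        Finset.sum_le_sum_of_subset_of_nonneg (Finset.filter_subset _ _)
          fun _ _ _ => (Real.exp_pos _).le
    _ = Real.exp (21 * r) * ∏ _i : R, ∑ k ∈ B, Real.exp (-(k : ℝ) ^ 2) := by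
        rw [Finset.prod_univ_sum, Finset.mul_sum]
        refine Finset.sum_congr rfl fun k _ => ?_
        rw [sub_eq_add_neg, Real.exp_add, ← Real.exp_sum, Finset.sum_neg_distrib]
    _ ≤ Real.exp (21 * r) * ∏ _i : R, ∑' k : ℤ, Real.exp (-(k : ℝ) ^ 2) := by
        gcongr
        exact summable_exp_neg_int_sq.sum_le_tsum _ fun _ _ => (Real.exp_pos _).le
    _ = _ := by
        rw [Finset.prod_const, mul_pow, ← Real.exp_nat_mul, Finset.card_univ, mul_comm (21 : ℝ)]

theorem norm_le_of_norm_sub_le {E : Type*} [NormedAddCommGroup E] {x z : E} (hx : ‖x‖ = 1)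
    (h : ‖x - z‖ ≤ 1 / 8) : ‖z‖ ≤ 9 / 8 := by
  have := norm_sub_norm_le z x
  rw [norm_sub_rev] at this
  linarith

/-- The unit sphere of a Euclidean space has nets of exponential size. -/
theorem exists_sphere_net : ∃ C : ℝ, 1 ≤ C ∧ ∀ (r : ℕ), 0 < r →
    ∃ S : Finset (EuclideanSpace ℝ (Fin r)), (S.card : ℝ) ≤ C ^ r ∧ (∀ z ∈ S, ‖z‖ ^ 2 ≤ 2) ∧
      ∀ x : EuclideanSpace ℝ (Fin r), ‖x‖ = 1 → ∃ z ∈ S, ‖x - z‖ ≤ 1 / 8 := by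
  classical
  refine ⟨Real.exp 21 * ∑' k : ℤ, Real.exp (-(k : ℝ) ^ 2), ?_, fun r hr => ?_⟩
  · refine one_le_mul_of_one_le_of_one_le (Real.one_le_exp (by norm_num)) ?_
    have := summable_exp_neg_int_sq.le_tsum 0 fun _ _ => (Real.exp_pos _).le
    simpa using this
  -- Rounding to this mesh gives a squared error of at most `r h² / 4 = 1/64`. A rounded unit vector
  -- has norm at most `9/8`, so `∑ kᵢ² ≤ 16 r (9/8)² ≤ 21 r`, which explains the radius `21`.
  set h : ℝ := 1 / (4 * Real.sqrt r) with hh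
  have hs : 0 < Real.sqrt r := Real.sqrt_pos.2 (by exact_mod_cast hr)
  have hs2 : Real.sqrt r ^ 2 = r := Real.sq_sqrt (by positivity)
  have hh0 : 0 < h := by positivity
  have hh2 : h ^ 2 * r = 1 / 16 := by
    rw [hh, div_pow, mul_pow, hs2]
    have : (r : ℝ) ≠ 0 := by positivity
    field_simp
    norm_num
  let φ : (Fin r → ℤ) → EuclideanSpace ℝ (Fin r) := fun k => WithLp.toLp 2 fun i => h * k i
  have hφ : ∀ k, ‖φ k‖ ^ 2 = h ^ 2 * ∑ i, (k i : ℝ) ^ 2 := fun k => by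
    rw [EuclideanSpace.norm_sq_eq, Finset.mul_sum]
    exact Finset.sum_congr rfl fun i _ => by simp [φ, mul_pow]
  have hcard := card_lattice_ball_le (R := Fin r)
  rw [Fintype.card_fin] at hcard
  refine ⟨((Fintype.piFinset fun _ : Fin r => Finset.Icc (-(21 * r : ℤ)) (21 * r)).filter
      fun k => ∑ i, (k i : ℝ) ^ 2 ≤ 21 * r).image φ, ?_, ?_, ?_⟩
  · exact (Nat.cast_le.2 Finset.card_image_le).trans hcard
  · intro z hz
    obtain ⟨k, hk, rfl⟩ := Finset.mem_image.1 hz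
    rw [hφ]
    have := mul_le_mul_of_nonneg_left (Finset.mem_filter.1 hk).2 (sq_nonneg h)
    nlinarith
  · intro x hx
    let k : Fin r → ℤ := fun i => round (x i / h)
    have hd : ‖x - φ k‖ ≤ 1 / 8 := by
      refine le_of_sq_le_sq ?_ (by norm_num)
      rw [EuclideanSpace.norm_sq_eq]
      have : ∀ i, ‖(x - φ k) i‖ ^ 2 ≤ h ^ 2 * (1 / 4) := fun i => by
        have h1 : (x - φ k) i = h * (x i / h - round (x i / h)) := by
          simp only [PiLp.sub_apply, φ, k]
          field_simp
        have h2 := abs_sub_round (x i / h)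
        rw [h1, Real.norm_eq_abs, sq_abs, mul_pow]
        gcongr
        rw [← sq_abs]
        nlinarith [abs_nonneg (x i / h - round (x i / h))]
      refine (Finset.sum_le_sum fun i _ => this i).trans ?_
      rw [Finset.sum_const, Finset.card_univ, Fintype.card_fin, nsmul_eq_mul]
      nlinarith
    have hz := norm_le_of_norm_sub_le hx hd
    have hk : ∑ i, (k i : ℝ) ^ 2 ≤ 21 * r := by
      have h1 := hφ k
      have h2 : ‖φ k‖ ^ 2 ≤ (9 / 8) ^ 2 := pow_le_pow_left₀ (norm_nonneg _) hz 2
      have h3 : h ^ 2 * ∑ i, (k i : ℝ) ^ 2 ≤ h ^ 2 * (21 * r) := by nlinarith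
      exact le_of_mul_le_mul_left h3 (by positivity)
    refine ⟨φ k, Finset.mem_image_of_mem _ (Finset.mem_filter.2 ⟨?_, hk⟩), hd⟩
    rw [Fintype.mem_piFinset]
    intro i
    have h1 : (k i : ℝ) ^ 2 ≤ 21 * r :=
      (Finset.single_le_sum (fun j _ => sq_nonneg (k j : ℝ)) (Finset.mem_univ i)).trans hk
    have h2 : (k i) ^ 2 ≤ 21 * (r : ℤ) := by exact_mod_cast h1
    rw [Finset.mem_Icc, ← abs_le]
    exact (Int.le_self_sq |k i|).trans (by rwa [sq_abs])

end LatticeNet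

/-! ### Operator norm, trace and nets. -/

section OperatorNorm

open scoped Matrix Matrix.Norms.L2Operator InnerProductSpace

variable {R : Type*} [Fintype R] [DecidableEq R]

theorem abs_dotProduct_mulVec_le (A : Matrix R R ℝ) (x y : EuclideanSpace ℝ R) :
    |x.ofLp ⬝ᵥ A *ᵥ y.ofLp| ≤ ‖A‖ * (‖x‖ * ‖y‖) := by
  have h1 : x.ofLp ⬝ᵥ A *ᵥ y.ofLp = ⟪x, Matrix.toEuclideanCLM (𝕜 := ℝ) A y⟫_ℝ := by
    simp [EuclideanSpace.inner_eq_star_dotProduct, dotProduct_comm]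
  rw [h1]
  refine (abs_real_inner_le_norm _ _).trans ?_
  have := (Matrix.toEuclideanCLM (𝕜 := ℝ) A).le_opNorm y
  rw [Matrix.l2_opNorm_toEuclideanCLM] at this
  nlinarith [norm_nonneg x]

theorem trace_le_card_mul_norm (A : Matrix R R ℝ) : A.trace ≤ Fintype.card R * ‖A‖ := by
  rw [Matrix.trace, ← nsmul_eq_mul, ← Finset.card_univ, ← Finset.sum_const]
  refine Finset.sum_le_sum fun i _ => ?_
  have := abs_dotProduct_mulVec_le A (EuclideanSpace.single i 1) (EuclideanSpace.single i 1)
  simp at this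
  exact (le_abs_self _).trans this

theorem Matrix.IsSymm.isSelfAdjoint_real {A : Matrix R R ℝ} (hA : A.IsSymm) : IsSelfAdjoint A := by
  rw [IsSelfAdjoint, Matrix.star_eq_conjTranspose, Matrix.conjTranspose_eq_transpose_of_trivial]
  exact hA

theorem norm_sq_le_trace_mul_transpose (A : Matrix R R ℝ) : ‖A‖ ^ 2 ≤ (A * Aᵀ).trace := by
  have h0 : (A * Aᵀ).trace = ∑ i, ∑ j, A i j ^ 2 := by
    simp [Matrix.trace, Matrix.mul_apply, sq]
  have h1 : 0 ≤ (A * Aᵀ).trace := by rw [h0]; positivity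
  have h2 : ‖A‖ ≤ Real.sqrt (A * Aᵀ).trace := by
    rw [← Matrix.l2_opNorm_toEuclideanCLM]
    refine ContinuousLinearMap.opNorm_le_bound _ (Real.sqrt_nonneg _) fun x => ?_
    refine le_of_sq_le_sq ?_ (by positivity)
    rw [mul_pow, Real.sq_sqrt h1, h0, EuclideanSpace.norm_sq_eq, EuclideanSpace.norm_sq_eq,
      Finset.sum_mul]
    refine Finset.sum_le_sum fun i _ => ?_
    simp only [Matrix.ofLp_toEuclideanCLM, Matrix.mulVec, dotProduct, Real.norm_eq_abs, sq_abs]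
    exact Finset.sum_mul_sq_le_sq_mul_sq _ _ _
  calc ‖A‖ ^ 2 ≤ Real.sqrt (A * Aᵀ).trace ^ 2 := pow_le_pow_left₀ (norm_nonneg _) h2 2
    _ = _ := Real.sq_sqrt h1

/-- For self-adjoint `A` the C*-identity gives `‖A ^ 2^j‖ = ‖A‖ ^ 2^j`, and the operator norm is at
most the Frobenius norm. This is why exponents are restricted to powers of two. -/
theorem norm_pow_le_trace_pow {A : Matrix R R ℝ} (hA : A.IsSymm) (j : ℕ) :
    ‖A‖ ^ (2 * 2 ^ j) ≤ (A ^ (2 * 2 ^ j)).trace := by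
  rw [mul_comm, pow_mul, ← hA.isSelfAdjoint_real.norm_pow_two_pow]
  refine (norm_sq_le_trace_mul_transpose _).trans (le_of_eq ?_)
  rw [Matrix.transpose_pow, hA.eq, ← sq, ← pow_mul]

/-- Moving a unit vector to the net changes the form by at most `(1/8 + 9/64) ‖A‖ ≤ ‖A‖ / 2`. Since
the norm of a symmetric matrix is its largest absolute Rayleigh quotient, this half can be absorbed.
-/
theorem norm_le_of_net {r : ℕ} {S : Finset (EuclideanSpace ℝ (Fin r))}
    (hS : ∀ x : EuclideanSpace ℝ (Fin r), ‖x‖ = 1 → ∃ z ∈ S, ‖x - z‖ ≤ 1 / 8)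
    {A : Matrix (Fin r) (Fin r) ℝ} (hA : A.IsSymm) {B : ℝ} (hB0 : 0 ≤ B)
    (hB : ∀ z ∈ S, |z.ofLp ⬝ᵥ A *ᵥ z.ofLp| ≤ B) : ‖A‖ ≤ 2 * B := by
  have hunit : ∀ x : EuclideanSpace ℝ (Fin r), ‖x‖ = 1 →
      |x.ofLp ⬝ᵥ A *ᵥ x.ofLp| ≤ B + 1 / 2 * ‖A‖ := by
    intro x hx
    obtain ⟨z, hz, hxz⟩ := hS x hx
    have h1 : x.ofLp ⬝ᵥ A *ᵥ x.ofLp = z.ofLp ⬝ᵥ A *ᵥ z.ofLp +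
        x.ofLp ⬝ᵥ A *ᵥ (x - z).ofLp + (x - z).ofLp ⬝ᵥ A *ᵥ z.ofLp := by
      simp only [WithLp.ofLp_sub, Matrix.mulVec_sub, dotProduct_sub, sub_dotProduct]
      ring
    have h2 := abs_dotProduct_mulVec_le A x (x - z)
    have h3 := abs_dotProduct_mulVec_le A (x - z) z
    have h4 := norm_le_of_norm_sub_le hx hxz
    have h5 := hB z hz
    have h6 : ‖x‖ * ‖x - z‖ ≤ 1 / 8 := by rw [hx, one_mul]; exact hxz
    have h7 : ‖x - z‖ * ‖z‖ ≤ 1 / 8 * (9 / 8) := by gcongr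
    have h8 := mul_le_mul_of_nonneg_left h6 (norm_nonneg A)
    have h9 := mul_le_mul_of_nonneg_left h7 (norm_nonneg A)
    rw [h1]
    refine (abs_add_three _ _ _).trans ?_
    nlinarith [norm_nonneg A]
  have hsym := (hA.isSelfAdjoint_real.map (Matrix.toEuclideanCLM (n := Fin r) (𝕜 := ℝ))).isSymmetric
  have h := ContinuousLinearMap.norm_eq_iSup_rayleighQuotient _ hsym
  have h2 : ‖A‖ ≤ B + 1 / 2 * ‖A‖ := by
    conv_lhs => rw [← Matrix.l2_opNorm_toEuclideanCLM, h]
    refine Real.iSup_le (fun x => ?_) (by positivity)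
    by_cases hx : x = 0
    · simp [hx]; positivity
    · have hx1 : ‖(‖x‖⁻¹ • x)‖ = 1 := norm_smul_inv_norm hx
      have := hunit _ hx1
      rw [← ContinuousLinearMap.rayleigh_smul _ x (inv_ne_zero (norm_ne_zero_iff.2 hx))]
      rw [ContinuousLinearMap.rayleighQuotient, ContinuousLinearMap.reApplyInnerSelf_apply, hx1]
      simpa [EuclideanSpace.inner_eq_star_dotProduct, dotProduct_comm, Matrix.mulVec_smul,
        abs_mul] using this
  linarith

end OperatorNorm

/-! ### The `O(√(log n))` operator norm bound. -/

section NormTail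

open scoped Matrix Matrix.Norms.L2Operator

theorem measurable_edgeMatrix_apply {V : Type*} [Fintype V] [DecidableEq V] {Ω : Type*}
    [MeasurableSpace Ω] {f : EdgeIndex V → Ω → ℝ} (hf : ∀ e, Measurable (f e)) (i j : V) :
    Measurable fun ω : EdgeIndex V → Ω => edgeMatrix (fun e => f e (ω e)) i j := by
  simp only [edgeMatrix, Matrix.of_apply]
  split_ifs
  · exact measurable_const
  · exact (hf _).comp (measurable_pi_apply _)

/-- Trace moments of a random symmetric matrix with centred bounded entries, of order comparable
to its size. -/
theorem exists_integral_trace_pow_le (b : ℝ) (hb0 : 0 ≤ b) : ∃ C : ℝ, 1 ≤ C ∧ ∃ K : ℝ, 0 ≤ K ∧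
    ∀ (r : ℕ), 0 < r → ∀ {Ω : Type} [MeasurableSpace Ω] (μ : EdgeIndex (Fin r) → Measure Ω)
    [∀ e, IsProbabilityMeasure (μ e)] (g : EdgeIndex (Fin r) → Ω → ℝ), (∀ e, Measurable (g e)) →
    (∀ e y, |g e y| ≤ b) → (∀ e, ∫ y, g e y ∂μ e = 0) → ∀ m : ℕ, 0 < m →
    ∫ ω, (edgeMatrix (fun e => g e (ω e)) ^ (2 * m)).trace ∂Measure.pi μ ≤
      r * (C ^ r * (2 * (K * m) ^ m)) := by
  obtain ⟨C, hC, hnet⟩ := exists_sphere_net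
  refine ⟨C, hC, 4 * (4 * Real.exp (4 * b ^ 2)), by positivity,
    fun r hr Ω _ μ _ g hg hb hmean m hm => ?_⟩
  obtain ⟨S, hScard, hS2, hS⟩ := hnet r hr
  have hne : S.Nonempty := by
    obtain ⟨z, hz, _⟩ := hS (EuclideanSpace.single ⟨0, hr⟩ 1) (by simp)
    exact ⟨z, hz⟩
  -- The norm is at most twice the maximum over the net, and the maximum of even powers is at most
  -- their sum; hence the factor `4 ^ m`.
  have hpt : ∀ ω : EdgeIndex (Fin r) → Ω, (edgeMatrix (fun e => g e (ω e)) ^ (2 * m)).trace ≤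
      r * ∑ z ∈ S, 4 ^ m * (z.ofLp ⬝ᵥ edgeMatrix (fun e => g e (ω e)) *ᵥ z.ofLp) ^ (2 * m) := by
    intro ω
    set A := edgeMatrix (fun e => g e (ω e))
    obtain ⟨z, hz, hmax⟩ := S.exists_max_image (fun z => |z.ofLp ⬝ᵥ A *ᵥ z.ofLp|) hne
    have h1 := norm_le_of_net hS (edgeMatrix_isSymm _ : A.IsSymm) (abs_nonneg _) hmax
    have h2 := trace_le_card_mul_norm (A ^ (2 * m))
    rw [Fintype.card_fin] at h2
    refine h2.trans ?_
    gcongr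
    calc ‖A ^ (2 * m)‖ ≤ ‖A‖ ^ (2 * m) := norm_pow_le' _ (by omega)
      _ ≤ (2 * |z.ofLp ⬝ᵥ A *ᵥ z.ofLp|) ^ (2 * m) := pow_le_pow_left₀ (norm_nonneg _) h1 _
      _ = 4 ^ m * (z.ofLp ⬝ᵥ A *ᵥ z.ofLp) ^ (2 * m) := by
        rw [mul_pow, pow_mul, pow_mul, pow_mul, sq_abs]
        norm_num
      _ ≤ ∑ z ∈ S, 4 ^ m * (z.ofLp ⬝ᵥ A *ᵥ z.ofLp) ^ (2 * m) :=
        Finset.single_le_sum (f := fun z : EuclideanSpace ℝ (Fin r) =>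
          4 ^ m * (z.ofLp ⬝ᵥ A *ᵥ z.ofLp) ^ (2 * m))
          (fun z _ => mul_nonneg (by positivity) ((even_two_mul m).pow_nonneg _)) hz
  have hbd : ∀ (z : EuclideanSpace ℝ (Fin r)) (ω : EdgeIndex (Fin r) → Ω),
      |z.ofLp ⬝ᵥ edgeMatrix (fun e => g e (ω e)) *ᵥ z.ofLp| ≤
        ∑ e : EdgeIndex (Fin r), |2 * ((e : Sym2 (Fin r)).map z.ofLp).mul| * b := by
    intro z ω
    rw [dotProduct_edgeMatrix_mulVec]
    refine (Finset.abs_sum_le_sum_abs _ _).trans (Finset.sum_le_sum fun e _ => ?_)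
    rw [abs_mul]
    gcongr
    exact hb _ _
  have hmeas : ∀ z : EuclideanSpace ℝ (Fin r), Measurable fun ω : EdgeIndex (Fin r) → Ω =>
      z.ofLp ⬝ᵥ edgeMatrix (fun e => g e (ω e)) *ᵥ z.ofLp := by
    intro z
    simp_rw [dotProduct_edgeMatrix_mulVec]
    exact Finset.measurable_sum _ fun e _ => ((hg e).comp (measurable_pi_apply e)).const_mul _
  have hint : ∀ z ∈ S, Integrable (fun ω : EdgeIndex (Fin r) → Ω =>
      4 ^ m * (z.ofLp ⬝ᵥ edgeMatrix (fun e => g e (ω e)) *ᵥ z.ofLp) ^ (2 * m)) (Measure.pi μ) := by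
    intro z _
    refine Integrable.const_mul ?_ _
    refine Integrable.of_bound
      (C := (∑ e : EdgeIndex (Fin r), |2 * ((e : Sym2 (Fin r)).map z.ofLp).mul| * b) ^ (2 * m))
      ((hmeas z).pow_const _).aestronglyMeasurable (Filter.Eventually.of_forall fun ω => ?_)
    rw [Real.norm_eq_abs, abs_pow]
    exact pow_le_pow_left₀ (abs_nonneg _) (hbd z ω) _
  calc ∫ ω, (edgeMatrix (fun e => g e (ω e)) ^ (2 * m)).trace ∂Measure.pi μ
      ≤ ∫ ω, r * ∑ z ∈ S, 4 ^ m * (z.ofLp ⬝ᵥ edgeMatrix (fun e => g e (ω e)) *ᵥ z.ofLp) ^ (2 * m)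
          ∂Measure.pi μ := by
        refine integral_mono_of_nonneg (Filter.Eventually.of_forall fun ω => ?_)
          ((integrable_finsetSum _ hint).const_mul _) (Filter.Eventually.of_forall hpt)
        set A := edgeMatrix (fun e => g e (ω e)) with hA
        have hAs : A.IsSymm := edgeMatrix_isSymm _
        change 0 ≤ (A ^ (2 * m)).trace
        have h1 : A ^ (2 * m) = A ^ m * (A ^ m)ᵀ := by
          rw [Matrix.transpose_pow, hAs.eq, ← pow_add, two_mul]
        rw [h1]
        exact (sq_nonneg _).trans (norm_sq_le_trace_mul_transpose _)
    _ = r * ∑ z ∈ S, 4 ^ m * ∫ ω, (z.ofLp ⬝ᵥ edgeMatrix (fun e => g e (ω e)) *ᵥ z.ofLp) ^ (2 * m)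
          ∂Measure.pi μ := by
        rw [integral_const_mul, integral_finsetSum _ hint]
        simp_rw [integral_const_mul]
    _ ≤ r * ∑ z ∈ S, 4 ^ m * (2 * (4 * Real.exp (4 * b ^ 2) * m) ^ m) := by
        gcongr with z hz
        refine integral_quadratic_pow_le μ g hg hb0 hb hmean _ ?_ hm
        have := hS2 z hz
        rw [EuclideanSpace.norm_sq_eq] at this
        simpa [dotProduct, ← sq] using this
    _ = r * ((S.card : ℝ) * (2 * (4 * (4 * Real.exp (4 * b ^ 2)) * m) ^ m)) := by
        rw [Finset.sum_const, nsmul_eq_mul, mul_assoc 4 (4 * _) (m : ℝ), mul_pow (4 : ℝ) _ m]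
        ring
    _ ≤ _ := by gcongr

theorem integral_two_point (F : Bool → ℝ) :
    ∫ y, F y ∂(bernoulliMeasure true false (⟨1 / 3, by norm_num, by norm_num⟩ : unitInterval)) =
      1 / 3 * F true + 2 / 3 * F false := by
  rw [integral_bernoulliMeasure]
  norm_num [smul_eq_mul]

/-- The comparison entries equal `2` with probability `1/3` and `-1` with probability `2/3`: they
are centred, and the skewness keeps odd moments above `1` as well, which no symmetric law could do.
-/
theorem one_le_two_point_moment (k : ℕ) (hk : 2 ≤ k) :
    (1 : ℝ) ≤ 1 / 3 * 2 ^ k + 2 / 3 * (-1) ^ k := by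
  have h1 : (2 : ℝ) ^ 2 ≤ 2 ^ k := pow_le_pow_right₀ (by norm_num) hk
  rcases Nat.even_or_odd k with h | h
  · rw [h.neg_one_pow]; linarith
  · obtain ⟨j, rfl⟩ := h
    have h2 : (2 : ℝ) ^ 3 ≤ 2 ^ (2 * j + 1) := pow_le_pow_right₀ (by norm_num) (by omega)
    rw [Odd.neg_one_pow ⟨j, rfl⟩]
    linarith

theorem exists_two_pow_near {x : ℝ} (hx : 1 ≤ x) : ∃ j : ℕ, x ≤ 2 ^ j ∧ (2 : ℝ) ^ j ≤ 2 * x := by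
  obtain ⟨j, h1, h2⟩ := exists_nat_pow_near hx one_lt_two
  exact ⟨j + 1, h2.le, by rw [pow_succ]; linarith⟩

/-- The operator norm of a centred random symmetric matrix of size `n` whose entries are bounded
and have variance `O(log n / n)` is `O(√(log n))` with high probability. -/
theorem exists_norm_edgeMatrix_tail (c₀ : ℝ) : ∃ K : ℝ, 0 < K ∧
    ∀ (n : ℕ), 3 ≤ n → ∀ {Ω : Type} [MeasurableSpace Ω] (μ : EdgeIndex (Fin n) → Measure Ω)
    [∀ e, IsProbabilityMeasure (μ e)] (f : EdgeIndex (Fin n) → Ω → ℝ), (∀ e, Measurable (f e)) →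
    (∀ e y, |f e y| ≤ 1) → (∀ e, ∫ y, f e y ∂μ e = 0) → ∀ ρ : ℝ, 0 ≤ ρ → ρ ≤ 1 →
    (∀ e, ∫ y, f e y ^ 2 ∂μ e ≤ ρ) → n * ρ ≤ c₀ * Real.log n →
    (Measure.pi μ).real {ω | K * Real.sqrt (Real.log n) ≤ ‖edgeMatrix (fun e => f e (ω e))‖} ≤
      2 / n ^ 2 := by
  obtain ⟨C, hC, K, hK, hY⟩ := exists_integral_trace_pow_le 2 (by norm_num)
  set κ : ℕ := ⌈c₀⌉₊ + 4 with hκ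
  set Q : ℝ := C ^ κ * (K + 1) * Real.exp 3 with hQ
  have hQ0 : 0 < Q := by positivity
  refine ⟨Real.sqrt (2 * Q), by positivity, fun n hn Ω _ μ _ f hf hb hmean ρ hρ0 hρ1 hvar hnρ => ?_⟩
  have hn0 : (0 : ℝ) < n := by exact_mod_cast (by omega : 0 < n)
  have hlog : 1 ≤ Real.log n := by
    rw [Real.le_log_iff_exp_le hn0]
    have : (3 : ℝ) ≤ n := by exact_mod_cast hn
    linarith [Real.exp_one_lt_d9]
  -- The moment order is `2m` with `m` a power of two between `log n` and `2 log n`.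
  obtain ⟨j, hj1, hj2⟩ := exists_two_pow_near hlog
  set m : ℕ := 2 ^ j with hm
  have hm0 : 0 < m := by positivity
  have hmr : (m : ℝ) = 2 ^ j := by rw [hm]; push_cast; rfl
  rw [← hmr] at hj1 hj2
  have hm1 : (1 : ℝ) ≤ m := hlog.trans hj1
  -- The comparison dimension must exceed `n ρ` plus the walk length, yet stay below `κ m` so that
  -- the net factor `C ^ r` is only an `m`-th power of a constant.
  set r : ℕ := ⌈c₀ * Real.log n⌉₊ + (2 * m + 1) with hr
  have hr1 : n * ρ + ((2 * m : ℕ) : ℝ) ≤ r := by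
    rw [hr]; push_cast
    linarith [Nat.le_ceil (c₀ * Real.log n)]
  have hr2 : r ≤ κ * m := by
    have h1 : ⌈c₀ * Real.log n⌉₊ ≤ ⌈c₀⌉₊ * m := by
      rw [Nat.ceil_le]; push_cast
      exact mul_le_mul (Nat.le_ceil _) hj1 (by linarith) (by positivity)
    rw [hr, hκ]
    nlinarith
  have hr0 : 0 < r := by omega
  -- Entries bounded by `1` have higher moments dominated by the variance.
  have hmom : ∀ e (k : ℕ), 2 ≤ k → |∫ y, f e y ^ k ∂μ e| ≤ ρ := by
    intro e k hk
    refine (abs_integral_le_integral_abs).trans (le_trans ?_ (hvar e))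
    refine integral_mono_of_nonneg (Filter.Eventually.of_forall fun _ => abs_nonneg _) ?_
      (Filter.Eventually.of_forall fun y => ?_)
    · refine Integrable.of_bound (C := 1) ((hf e).pow_const 2).aestronglyMeasurable
        (Filter.Eventually.of_forall fun y => ?_)
      rw [Real.norm_eq_abs, abs_pow]
      exact pow_le_one₀ (abs_nonneg _) (hb e y)
    · simp only
      rw [abs_pow, ← sq_abs]
      exact pow_le_pow_of_le_one (abs_nonneg _) (hb e y) hk
  have hcomp := integral_trace_pow_le_of_comparison (V := Fin n) (R := Fin r) (μ := μ) (f := f)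
    (ν := fun _ => bernoulliMeasure true false
      (⟨1 / 3, by norm_num, by norm_num⟩ : unitInterval))
    (g := fun _ y => if y = true then 2 else -1) hf hb
    (fun _ => measurable_of_finite _) (b' := 2) (fun _ y => by cases y <;> norm_num)
    hρ0 hρ1 hmean hmom (fun _ => by rw [integral_two_point]; norm_num)
    (fun _ k hk => by
      rw [integral_two_point (fun y => (if y = true then (2 : ℝ) else -1) ^ k)]
      simpa using one_le_two_point_moment k hk) (2 * m)
    (by simpa using hr1) (by simp; omega)
  have hYr := hY r hr0 (fun _ => bernoulliMeasure true false
      (⟨1 / 3, by norm_num, by norm_num⟩ : unitInterval)) (fun _ y => if y = true then 2 else -1)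
      (fun _ => measurable_of_finite _) (fun _ y => by cases y <;> norm_num)
      (fun _ => by rw [integral_two_point]; norm_num) m hm0
  rw [Fintype.card_fin, Fintype.card_fin] at hcomp
  have hX : ∫ ω, (edgeMatrix (fun e => f e (ω e)) ^ (2 * m)).trace ∂Measure.pi μ ≤
      n * (C ^ r * (2 * (K * m) ^ m)) := by
    have h1 := hcomp.trans (mul_le_mul_of_nonneg_left hYr hn0.le)
    have hr0' : (0 : ℝ) < r := by exact_mod_cast hr0
    refine le_of_mul_le_mul_left (h1.trans (le_of_eq ?_)) hr0'
    ring
  have hX2 : ∫ ω, (edgeMatrix (fun e => f e (ω e)) ^ (2 * m)).trace ∂Measure.pi μ ≤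
      2 * n * (C ^ κ * (K + 1) * m) ^ m := by
    refine hX.trans ?_
    have h1 : C ^ r ≤ (C ^ κ) ^ m := by
      rw [← pow_mul]; exact pow_le_pow_right₀ hC hr2
    have h2 : (K * m) ^ m ≤ ((K + 1) * m) ^ m := by gcongr; linarith
    calc n * (C ^ r * (2 * (K * m) ^ m)) ≤ n * ((C ^ κ) ^ m * (2 * ((K + 1) * m) ^ m)) := by gcongr
      _ = _ := by rw [mul_assoc (C ^ κ), mul_pow (C ^ κ)]; ring
  set t : ℝ := Real.sqrt (2 * Q) * Real.sqrt (Real.log n) with ht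
  have ht2 : t ^ 2 = 2 * Q * Real.log n := by
    rw [ht, mul_pow, Real.sq_sqrt (by positivity), Real.sq_sqrt (by linarith)]
  have ht0 : 0 ≤ t := by positivity
  have htm : (C ^ κ * (K + 1) * m * Real.exp 3) ^ m ≤ t ^ (2 * m) := by
    rw [pow_mul, ht2]
    refine pow_le_pow_left₀ (by positivity) ?_ _
    calc C ^ κ * (K + 1) * m * Real.exp 3 = Q * m := by rw [hQ]; ring
      _ ≤ Q * (2 * Real.log n) := by gcongr
      _ = _ := by ring
  have hsub : {ω : EdgeIndex (Fin n) → Ω | t ≤ ‖edgeMatrix (fun e => f e (ω e))‖} ⊆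
      {ω | t ^ (2 * m) ≤ (edgeMatrix (fun e => f e (ω e)) ^ (2 * m)).trace} := by
    intro ω hω
    exact (pow_le_pow_left₀ ht0 hω _).trans (norm_pow_le_trace_pow (edgeMatrix_isSymm _) j)
  have hnonneg : ∀ ω : EdgeIndex (Fin n) → Ω,
      0 ≤ (edgeMatrix (fun e => f e (ω e)) ^ (2 * m)).trace := fun ω =>
    (pow_nonneg (norm_nonneg (edgeMatrix (fun e => f e (ω e)))) (2 * m)).trans (norm_pow_le_trace_pow (edgeMatrix_isSymm _) j)
  have hint : Integrable (fun ω : EdgeIndex (Fin n) → Ω =>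
      (edgeMatrix (fun e => f e (ω e)) ^ (2 * m)).trace) (Measure.pi μ) := by
    simp only [Matrix.trace_pow_eq_sum_walk]
    refine integrable_finsetSum _ fun w _ => ?_
    split_ifs
    · refine Integrable.of_bound (C := 1) (Finset.measurable_prod _ fun t _ =>
        measurable_edgeMatrix_apply hf _ _).aestronglyMeasurable (Filter.Eventually.of_forall fun ω => ?_)
      rw [Real.norm_eq_abs, Finset.abs_prod]
      refine Finset.prod_le_one (fun _ _ => abs_nonneg _) fun t _ => ?_
      simp only [edgeMatrix, Matrix.of_apply]
      split_ifs
      · simp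
      · exact hb _ _
    · exact integrable_zero _ _ _
  have hmarkov := mul_meas_ge_le_integral_of_nonneg (Filter.Eventually.of_forall hnonneg) hint
    (t ^ (2 * m))
  have hP := measureReal_mono (μ := Measure.pi μ) hsub
  have hB : 0 < C ^ κ * (K + 1) * m := by positivity
  have h5 : (C ^ κ * (K + 1) * m * Real.exp 3) ^ m * (Measure.pi μ).real
      {ω | t ≤ ‖edgeMatrix (fun e => f e (ω e))‖} ≤ 2 * n * (C ^ κ * (K + 1) * m) ^ m := by
    calc _ ≤ t ^ (2 * m) * (Measure.pi μ).real
            {ω | t ^ (2 * m) ≤ (edgeMatrix (fun e => f e (ω e)) ^ (2 * m)).trace} :=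
        mul_le_mul htm hP measureReal_nonneg (by positivity)
      _ ≤ _ := hmarkov.trans hX2
  -- The factor `exp 3` built into `Q` gains `exp (3m) ≥ n ^ 3` in Markov's inequality. One power of
  -- `n` pays for the dimension factor of the trace, leaving `2 / n ^ 2`.
  have h6 : (n : ℝ) ^ 3 ≤ Real.exp 3 ^ m := by
    calc (n : ℝ) ^ 3 = Real.exp (3 * Real.log n) := by
          rw [mul_comm, Real.exp_mul, Real.exp_log hn0]; norm_cast
      _ ≤ Real.exp (m * 3) := by rw [Real.exp_le_exp]; linarith
      _ = _ := Real.exp_nat_mul _ _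
  rw [mul_pow, mul_assoc, mul_comm (2 * (n : ℝ))] at h5
  have h7 := le_of_mul_le_mul_left h5 (by positivity)
  rw [le_div_iff₀ (by positivity)]
  have h8 : (n : ℝ) ^ 3 * (Measure.pi μ).real
      {ω | t ≤ ‖edgeMatrix (fun e => f e (ω e))‖} ≤ 2 * n :=
    (mul_le_mul_of_nonneg_right h6 measureReal_nonneg).trans h7
  refine le_of_mul_le_mul_left (le_trans (le_of_eq ?_) (h8.trans (le_of_eq ?_))) hn0 <;> ring

end NormTail

/-! ### Deterministic perturbation of the normalized Laplacian. -/

section Deterministic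

open scoped Matrix Matrix.Norms.L2Operator InnerProductSpace

variable {V : Type*} [Fintype V] [DecidableEq V]

/-- The difference is `(d - g) / (√g √d (√g + √d))`; use `√g + √d ≥ √d` and `g ≥ c`. Only a lower
bound on `g` enters, so unusually large degrees are harmless. -/
theorem inv_sqrt_sub_inv_sqrt_sq_le {g d c : ℝ} (hc : 0 < c) (hg : c ≤ g) (hd : 0 < d) :
    ((Real.sqrt g)⁻¹ - (Real.sqrt d)⁻¹) ^ 2 ≤ (g - d) ^ 2 / (d ^ 2 * c) := by
  have hg0 := hc.trans_le hg
  set α := Real.sqrt g with hα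
  set β := Real.sqrt d with hβ
  have hα0 : 0 < α := Real.sqrt_pos.2 hg0
  have hβ0 : 0 < β := Real.sqrt_pos.2 hd
  have hα2 : α ^ 2 = g := Real.sq_sqrt hg0.le
  have hβ2 : β ^ 2 = d := Real.sq_sqrt hd.le
  rw [← hα2] at hg
  rw [← hα2, ← hβ2]
  have h1 : (α⁻¹ - β⁻¹) ^ 2 = (α - β) ^ 2 / (α ^ 2 * β ^ 2) := by
    field_simp
    ring
  rw [h1, div_le_div_iff₀ (by positivity) (by positivity)]
  have h2 : (α ^ 2 - β ^ 2) ^ 2 = (α - β) ^ 2 * (α + β) ^ 2 := by ring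
  rw [h2]
  have h3 : β ^ 2 ≤ (α + β) ^ 2 := by nlinarith
  calc (α - β) ^ 2 * ((β ^ 2) ^ 2 * c) = (α - β) ^ 2 * (β ^ 2 * (c * β ^ 2)) := by ring
    _ ≤ (α - β) ^ 2 * ((α + β) ^ 2 * (α ^ 2 * β ^ 2)) := by gcongr
    _ = _ := by ring

/-- Replacing the actual degrees by a typical degree in a rank one form. -/
theorem abs_rank_one_form_sub_le {g τ : V → ℝ} (hτ : ∀ i, τ i ^ 2 = 1) {c d η : ℝ} (hc : 0 < c)
    (hcd : c ≤ d) (hη : 0 ≤ η) (hg : ∀ i, c ≤ g i)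
    (hgd : ∑ i, (g i - d) ^ 2 ≤ η ^ 2 * Fintype.card V) (x : V → ℝ) :
    |(∑ i, τ i * ((Real.sqrt (g i))⁻¹ * x i)) ^ 2 - (∑ i, τ i * x i) ^ 2 / d| ≤
      2 * η * Fintype.card V / (d * c) * ∑ i, x i ^ 2 := by
  have hd := hc.trans_le hcd
  set w := (Real.sqrt d)⁻¹ with hw
  have hw2 : w ^ 2 = 1 / d := by rw [hw, inv_pow, Real.sq_sqrt hd.le, one_div]
  set n : ℝ := (Fintype.card V : ℝ)
  have hn0 : 0 ≤ n := by positivity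
  have hX : 0 ≤ ∑ i, x i ^ 2 := by positivity
  -- A difference of two squares. By Cauchy-Schwarz the first factor is small through the mean
  -- square deviation of the degrees, and the second costs at most `4 n / c`.
  have h1 : (∑ i, τ i * ((Real.sqrt (g i))⁻¹ * x i)) ^ 2 - (∑ i, τ i * x i) ^ 2 / d =
      (∑ i, x i * (τ i * ((Real.sqrt (g i))⁻¹ - w))) *
        (∑ i, x i * (τ i * ((Real.sqrt (g i))⁻¹ + w))) := by
    have e1 : ∑ i, x i * (τ i * ((Real.sqrt (g i))⁻¹ - w)) =
        ∑ i, τ i * ((Real.sqrt (g i))⁻¹ * x i) - w * ∑ i, τ i * x i := by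
      rw [Finset.mul_sum, ← Finset.sum_sub_distrib]
      exact Finset.sum_congr rfl fun i _ => by ring
    have e2 : ∑ i, x i * (τ i * ((Real.sqrt (g i))⁻¹ + w)) =
        ∑ i, τ i * ((Real.sqrt (g i))⁻¹ * x i) + w * ∑ i, τ i * x i := by
      rw [Finset.mul_sum, ← Finset.sum_add_distrib]
      exact Finset.sum_congr rfl fun i _ => by ring
    rw [e1, e2, div_eq_mul_one_div, ← hw2]
    ring
  have h2 : (∑ i, x i * (τ i * ((Real.sqrt (g i))⁻¹ - w))) ^ 2 ≤
      (∑ i, x i ^ 2) * (η ^ 2 * n / (d ^ 2 * c)) := by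
    refine (Finset.sum_mul_sq_le_sq_mul_sq _ _ _).trans ?_
    gcongr
    calc ∑ i, (τ i * ((Real.sqrt (g i))⁻¹ - w)) ^ 2 ≤ ∑ i, (g i - d) ^ 2 / (d ^ 2 * c) :=
          Finset.sum_le_sum fun i _ => by
            rw [mul_pow, hτ, one_mul]
            exact inv_sqrt_sub_inv_sqrt_sq_le hc (hg i) hd
      _ = (∑ i, (g i - d) ^ 2) / (d ^ 2 * c) := by rw [Finset.sum_div]
      _ ≤ _ := by gcongr
  have h3 : (∑ i, x i * (τ i * ((Real.sqrt (g i))⁻¹ + w))) ^ 2 ≤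
      (∑ i, x i ^ 2) * (n * (4 / c)) := by
    refine (Finset.sum_mul_sq_le_sq_mul_sq _ _ _).trans ?_
    gcongr
    calc ∑ i, (τ i * ((Real.sqrt (g i))⁻¹ + w)) ^ 2 ≤ ∑ _i : V, 4 / c :=
          Finset.sum_le_sum fun i _ => by
            rw [mul_pow, hτ, one_mul]
            have hgi := hc.trans_le (hg i)
            have e1 : (Real.sqrt (g i))⁻¹ ^ 2 ≤ 1 / c := by
              rw [inv_pow, Real.sq_sqrt hgi.le, ← one_div]
              exact one_div_le_one_div_of_le hc (hg i)
            have e2 : w ^ 2 ≤ 1 / c := by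
              rw [hw2]; exact one_div_le_one_div_of_le hc hcd
            have e3 : 4 / c = 4 * (1 / c) := by ring
            nlinarith [sq_nonneg ((Real.sqrt (g i))⁻¹ - w)]
      _ = _ := by rw [Finset.sum_const, nsmul_eq_mul, Finset.card_univ]
  rw [h1]
  refine abs_le_of_sq_le_sq ?_ (by positivity)
  rw [mul_pow]
  refine (mul_le_mul h2 h3 (sq_nonneg _) (by positivity)).trans (le_of_eq ?_)
  field_simp
  ring

/-- The quadratic form of a normalized Laplacian whose adjacency matrix is close in norm to the
block matrix `a + b τ τᵀ` and whose degrees are on average close to `d`. -/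
theorem abs_normalizedLaplacian_form_sub_le {A : Matrix V V ℝ} {g τ : V → ℝ}
    (hτ : ∀ i, τ i ^ 2 = 1) {a b c d η : ℝ} (ha : 0 ≤ a) (hb : 0 ≤ b) (hc : 0 < c)
    (hcd : c ≤ d) (hη : 0 ≤ η) (hg : ∀ i, c ≤ g i)
    (hgd : ∑ i, (g i - d) ^ 2 ≤ η ^ 2 * Fintype.card V)
    (hA : ‖A - Matrix.of fun i j => a + b * (τ i * τ j)‖ ≤ η)
    (hab : (a + b) * Fintype.card V ≤ 2 * d) (x : EuclideanSpace ℝ V) :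
    |x.ofLp ⬝ᵥ (Matrix.diagonal (fun i => (Real.sqrt (g i))⁻¹) * (Matrix.diagonal g - A) *
        Matrix.diagonal (fun i => (Real.sqrt (g i))⁻¹)) *ᵥ x.ofLp -
      (‖x‖ ^ 2 - a / d * (∑ i, x i) ^ 2 - b / d * (∑ i, τ i * x i) ^ 2)| ≤
      5 * η / c * ‖x‖ ^ 2 := by
  have hd := hc.trans_le hcd
  set N : Matrix V V ℝ := Matrix.of fun i j => a + b * (τ i * τ j) with hN
  set y : EuclideanSpace ℝ V := WithLp.toLp 2 fun i => (Real.sqrt (g i))⁻¹ * x i with hy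
  have hxx : ‖x‖ ^ 2 = ∑ i, x i ^ 2 := by
    rw [EuclideanSpace.norm_sq_eq]; simp
  have hyy : ‖y‖ ^ 2 = ∑ i, ((Real.sqrt (g i))⁻¹ * x i) ^ 2 := by
    simp only [EuclideanSpace.norm_sq_eq, hy, Real.norm_eq_abs, sq_abs]
  have hyle : ‖y‖ ^ 2 ≤ ‖x‖ ^ 2 / c := by
    rw [hyy, hxx, Finset.sum_div]
    refine Finset.sum_le_sum fun i _ => ?_
    have hgi := hc.trans_le (hg i)
    rw [mul_pow, inv_pow, Real.sq_sqrt hgi.le, mul_comm, ← div_eq_mul_inv]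
    exact div_le_div_of_nonneg_left (sq_nonneg _) hc (hg i)
  have hform : x.ofLp ⬝ᵥ (Matrix.diagonal (fun i => (Real.sqrt (g i))⁻¹) * (Matrix.diagonal g - A) *
        Matrix.diagonal (fun i => (Real.sqrt (g i))⁻¹)) *ᵥ x.ofLp =
      ‖x‖ ^ 2 - (y.ofLp ⬝ᵥ (A - N) *ᵥ y.ofLp + a * (∑ i, (Real.sqrt (g i))⁻¹ * x i) ^ 2 +
        b * (∑ i, τ i * ((Real.sqrt (g i))⁻¹ * x i)) ^ 2) := by
    have e1 : Matrix.diagonal (fun i => (Real.sqrt (g i))⁻¹) *ᵥ x.ofLp = y.ofLp := by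
      ext i; simp [Matrix.mulVec_diagonal, hy]
    have e2 : x.ofLp ᵥ* Matrix.diagonal (fun i => (Real.sqrt (g i))⁻¹) = y.ofLp := by
      ext i; simp [Matrix.vecMul_diagonal, hy, mul_comm]
    have e3 : y.ofLp ⬝ᵥ N *ᵥ y.ofLp = a * (∑ i, (Real.sqrt (g i))⁻¹ * x i) ^ 2 +
        b * (∑ i, τ i * ((Real.sqrt (g i))⁻¹ * x i)) ^ 2 := by
      have : ∀ i, y.ofLp i = (Real.sqrt (g i))⁻¹ * x i := fun i => rfl
      simp only [← this]
      rw [sq, sq, Finset.sum_mul_sum, Finset.sum_mul_sum, Finset.mul_sum, Finset.mul_sum,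
        ← Finset.sum_add_distrib]
      simp only [dotProduct, Matrix.mulVec, hN, Matrix.of_apply, Finset.mul_sum]
      refine Finset.sum_congr rfl fun i _ => ?_
      rw [← Finset.sum_add_distrib]
      exact Finset.sum_congr rfl fun j _ => by ring
    have e4 : y.ofLp ⬝ᵥ Matrix.diagonal g *ᵥ y.ofLp = ‖x‖ ^ 2 := by
      rw [hxx]
      refine Finset.sum_congr rfl fun i _ => ?_
      have hgi := hc.trans_le (hg i)
      have hs : Real.sqrt (g i) ≠ 0 := (Real.sqrt_pos.2 hgi).ne'
      simp only [Matrix.mulVec_diagonal, hy]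
      nth_rewrite 2 [← Real.sq_sqrt hgi.le]
      field_simp
    rw [← Matrix.mulVec_mulVec, ← Matrix.mulVec_mulVec, e1, Matrix.dotProduct_mulVec, e2,
      Matrix.sub_mulVec, Matrix.sub_mulVec, dotProduct_sub, dotProduct_sub, e3, e4]
    ring
  have h1 : |y.ofLp ⬝ᵥ (A - N) *ᵥ y.ofLp| ≤ η / c * ‖x‖ ^ 2 := by
    refine (abs_dotProduct_mulVec_le _ _ _).trans ?_
    calc ‖A - N‖ * (‖y‖ * ‖y‖) ≤ η * (‖x‖ ^ 2 / c) := by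
          rw [← sq]; gcongr
      _ = _ := by ring
  have h2 := abs_rank_one_form_sub_le (τ := fun _ => 1) (by simp) hc hcd hη hg hgd x.ofLp
  have h3 := abs_rank_one_form_sub_le hτ hc hcd hη hg hgd x.ofLp
  simp only [one_mul] at h2
  rw [← hxx] at h2 h3
  -- Of the final error `5 η / c`, the two rank one replacements account for `4 η / c` and the noise
  -- `A - N` for `η / c`.
  have h4 : (a + b) * (2 * η * Fintype.card V / (d * c) * ‖x‖ ^ 2) ≤ 4 * η / c * ‖x‖ ^ 2 := by
    calc (a + b) * (2 * η * Fintype.card V / (d * c) * ‖x‖ ^ 2)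
        = ((a + b) * Fintype.card V) * (2 * η / (d * c) * ‖x‖ ^ 2) := by ring
      _ ≤ (2 * d) * (2 * η / (d * c) * ‖x‖ ^ 2) := by gcongr
      _ = _ := by field_simp; ring
  rw [hform]
  have h5 := mul_le_mul_of_nonneg_left h2 ha
  have h6 := mul_le_mul_of_nonneg_left h3 hb
  rw [← abs_of_nonneg ha, ← abs_mul, abs_of_nonneg ha] at h5
  rw [← abs_of_nonneg hb, ← abs_mul, abs_of_nonneg hb] at h6
  rw [abs_le] at h1 h5 h6 ⊢
  have e5 : 5 * η / c * ‖x‖ ^ 2 = η / c * ‖x‖ ^ 2 + 4 * η / c * ‖x‖ ^ 2 := by ring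
  have e6 : a / d * (∑ i, x i) ^ 2 = a * ((∑ i, x i) ^ 2 / d) := by ring
  have e7 : b / d * (∑ i, τ i * x i) ^ 2 = b * ((∑ i, τ i * x i) ^ 2 / d) := by ring
  rw [e5, e6, e7]
  constructor <;> linarith

/-- The eigenvalues of a signed graph whose adjacency matrix is close to a balanced two block
matrix. -/
theorem SignedGraph.lapEigenvalue_of_near_blocks {n : ℕ} (G : SignedGraph (Fin n)) {τ : Fin n → ℝ}
    (hτ : ∀ i, τ i ^ 2 = 1) (hτ0 : ∑ i, τ i = 0) (hn : 0 < n)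
    {a b c d η : ℝ} (ha : 0 ≤ a) (hab' : a ≤ b) (hc : 0 < c)
    (hcd : c ≤ d) (hη : 0 ≤ η) (hg : ∀ i, c ≤ (G.degree i : ℝ))
    (hgd : ∑ i, ((G.degree i : ℝ) - d) ^ 2 ≤ η ^ 2 * n)
    (hA : ‖G.adjacency - Matrix.of fun i j => a + b * (τ i * τ j)‖ ≤ η)
    (hab : (a + b) * n ≤ 2 * d) :
    (∀ ℓ : Fin n, (ℓ : ℕ) = 0 → |G.lapEigenvalue ℓ - (1 - b * n / d)| ≤ 5 * η / c) ∧
    (∀ ℓ : Fin n, (ℓ : ℕ) = 1 → |G.lapEigenvalue ℓ - (1 - a * n / d)| ≤ 5 * η / c) ∧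
    (∀ ℓ : Fin n, 2 ≤ (ℓ : ℕ) → |G.lapEigenvalue ℓ - 1| ≤ 5 * η / c) := by
  have hd := hc.trans_le hcd
  have hn0 : (0 : ℝ) < n := by exact_mod_cast hn
  set s := (Real.sqrt n)⁻¹ with hs
  have hs2 : s ^ 2 = 1 / n := by rw [hs, inv_pow, Real.sq_sqrt hn0.le, one_div]
  set v : EuclideanSpace ℝ (Fin n) := WithLp.toLp 2 fun i => s * τ i with hv
  set w : EuclideanSpace ℝ (Fin n) := WithLp.toLp 2 fun _ => s with hw
  have hv1 : ‖v‖ = 1 := by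
    refine (sq_eq_sq₀ (norm_nonneg _) zero_le_one).1 ?_
    rw [EuclideanSpace.norm_sq_eq]
    simp [hv, mul_pow, hτ, hs2, hn0.ne']
  have hw1 : ‖w‖ = 1 := by
    refine (sq_eq_sq₀ (norm_nonneg _) zero_le_one).1 ?_
    rw [EuclideanSpace.norm_sq_eq]
    simp [hw, hs2, hn0.ne']
  have hvx : ∀ x : EuclideanSpace ℝ (Fin n), ⟪v, x⟫_ℝ = s * ∑ i, τ i * x i := fun x => by
    rw [Finset.mul_sum, EuclideanSpace.inner_eq_star_dotProduct, dotProduct]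
    exact Finset.sum_congr rfl fun i _ => by simp [hv]; ring
  have hwx : ∀ x : EuclideanSpace ℝ (Fin n), ⟪w, x⟫_ℝ = s * ∑ i, x i := fun x => by
    rw [Finset.mul_sum, EuclideanSpace.inner_eq_star_dotProduct, dotProduct]
    exact Finset.sum_congr rfl fun i _ => by simp [hw]; ring
  have hvw : ⟪v, w⟫_ℝ = 0 := by
    rw [hvx]
    simp [hw, ← Finset.sum_mul, hτ0]
  have hb : 0 ≤ b := ha.trans hab'
  have key := (Matrix.isSymmetric_toEuclideanLin_iff.mpr
    G.normalizedLaplacian_isHermitian).eigenvalues_of_near_rank_two finrank_euclideanSpace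
    hv1 hw1 hvw (α := a * n / d) (β := b * n / d) (δ := 5 * η / c) (by positivity) (by gcongr)
    (fun x => by
      have h := abs_normalizedLaplacian_form_sub_le (A := G.adjacency) hτ ha hb hc hcd hη hg
        (by simpa using hgd) hA (by simpa using hab) x
      have e1 : ⟪Matrix.toEuclideanLin G.normalizedLaplacian x, x⟫_ℝ =
          x.ofLp ⬝ᵥ (Matrix.diagonal (fun i => (Real.sqrt (G.degree i : ℝ))⁻¹) *
            (Matrix.diagonal (fun i => (G.degree i : ℝ)) - G.adjacency) *
            Matrix.diagonal (fun i => (Real.sqrt (G.degree i : ℝ))⁻¹)) *ᵥ x.ofLp := by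
        simp only [EuclideanSpace.inner_eq_star_dotProduct, star_trivial, Matrix.ofLp_toLpLin,
          Matrix.toLin'_apply]
        rfl
      rw [e1, hvx, hwx, mul_pow, mul_pow, hs2]
      have e2 : a * n / d * (1 / n * (∑ i, x i) ^ 2) = a / d * (∑ i, x i) ^ 2 := by
        field_simp
      have e3 : b * n / d * (1 / n * (∑ i, τ i * x i) ^ 2) = b / d * (∑ i, τ i * x i) ^ 2 := by
        field_simp
      rw [e2, e3]
      exact h)
  -- The ascending index `ℓ` is the reversal of the descending one, so `ℓ = 0` corresponds to `j + 1
  -- = n`.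
  refine ⟨fun ℓ hℓ => key.1 _ ?_, fun ℓ hℓ => key.2.1 _ ?_, fun ℓ hℓ => key.2.2 _ ?_⟩ <;>
  · have := ℓ.2
    simp only [Fin.val_cast, Fin.val_rev, Fintype.card_fin]
    omega

end Deterministic

/-! ### The stochastic bisection model: means, concentration and degrees. -/

section Model

open scoped Matrix Matrix.Norms.L2Operator

theorem sum_edgeMatrix_row {V : Type*} [Fintype V] [DecidableEq V] (x : EdgeIndex V → ℝ) (i : V) :
    ∑ j, edgeMatrix x i j = ∑ e : EdgeIndex V, if i ∈ (e : Sym2 V) then x e else 0 := by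
  have h1 : ∀ e : EdgeIndex V, (if i ∈ (e : Sym2 V) then x e else 0) =
      ∑ j, if (e : Sym2 V) = s(i, j) then x e else 0 := by
    intro e
    split_ifs with h
    · obtain ⟨j, hj⟩ := h
      rw [Finset.sum_eq_single j]
      · rw [if_pos hj]
      · intro j' _ hj'
        rw [if_neg]
        rw [hj]
        exact fun h => hj' (Sym2.congr_right.1 h).symm
      · simp
    · rw [Finset.sum_eq_zero]
      intro j _
      rw [if_neg]
      exact fun hj => h (hj ▸ Sym2.mem_mk_left i j)
  simp_rw [h1]
  rw [Finset.sum_comm]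
  refine Finset.sum_congr rfl fun j _ => ?_
  simp only [edgeMatrix, Matrix.of_apply]
  split_ifs with h
  · refine (Finset.sum_eq_zero fun e _ => ?_).symm
    rw [if_neg]
    exact fun he => e.2 (he ▸ h)
  · rw [Finset.sum_eq_single ⟨s(i, j), h⟩]
    · simp
    · intro e _ he
      rw [if_neg]
      exact fun he' => he (Subtype.ext he')
    · simp

/-- The entry of the signed adjacency matrix determined by the choices at a pair. -/
def signedEntry (y : Bool × Bool) : ℝ := if y.1 = true then (if y.2 = true then -1 else 1) else 0

/-- The entry of the unsigned adjacency matrix determined by the choices at a pair. -/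
def unsignedEntry (y : Bool × Bool) : ℝ := if y.1 = true then 1 else 0

variable {n : ℕ}

theorem SignedGraph.adjacency_ofChoices (ω : EdgeIndex (Fin n) → Bool × Bool) :
    (SignedGraph.ofChoices ω).adjacency = edgeMatrix fun e => signedEntry (ω e) := by
  ext i j
  simp only [SignedGraph.adjacency, edgeMatrix, Matrix.of_apply]
  by_cases hd : (s(i, j) : Sym2 (Fin n)).IsDiag
  · rw [dif_pos hd, dif_neg]
    rintro ⟨h, _⟩
    exact h hd
  · rw [dif_neg hd]
    by_cases h : (ω ⟨s(i, j), hd⟩).1 = true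
    · rw [dif_pos ⟨hd, h⟩]
      simp only [SignedGraph.ofChoices, signedEntry, h, if_true]
      split_ifs <;> simp
    · rw [dif_neg]
      · simp [signedEntry, h]
      · rintro ⟨_, h'⟩
        exact h h'

theorem SignedGraph.degree_ofChoices (ω : EdgeIndex (Fin n) → Bool × Bool) (i : Fin n) :
    ((SignedGraph.ofChoices ω).degree i : ℝ) =
      ∑ j, edgeMatrix (fun e => unsignedEntry (ω e)) i j := by
  classical
  have h1 : ∀ j, edgeMatrix (fun e => unsignedEntry (ω e)) i j =
      if (SignedGraph.ofChoices ω).graph.Adj i j then 1 else 0 := by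
    intro j
    simp only [edgeMatrix, Matrix.of_apply]
    by_cases hd : (s(i, j) : Sym2 (Fin n)).IsDiag
    · rw [dif_pos hd, if_neg]
      rintro ⟨h, _⟩
      exact h hd
    · rw [dif_neg hd]
      by_cases h : (ω ⟨s(i, j), hd⟩).1 = true
      · rw [if_pos ⟨hd, h⟩]
        simp [unsignedEntry, h]
      · rw [if_neg]
        · simp [unsignedEntry, h]
        · rintro ⟨_, h'⟩
          exact h h'
  simp_rw [h1]
  rw [Finset.sum_boole, SignedGraph.degree, Set.ncard_eq_toFinset_card']
  congr 2
  ext j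
  simp

/-- The law of the choices at a pair. -/
noncomputable def choiceMeasure (p s : unitInterval) : Measure (Bool × Bool) :=
  (bernoulliMeasure true false p).prod (bernoulliMeasure true false s)

instance (p s : unitInterval) : IsProbabilityMeasure (choiceMeasure p s) := by
  unfold choiceMeasure; infer_instance

theorem integral_choiceMeasure (p s : unitInterval) (F : Bool × Bool → ℝ) :
    ∫ y, F y ∂choiceMeasure p s =
      p * (s * F (true, true) + (1 - s) * F (true, false)) +
        (1 - p) * (s * F (false, true) + (1 - s) * F (false, false)) := by
  rw [choiceMeasure, integral_prod _ Integrable.of_finite, integral_bernoulliMeasure,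
    integral_bernoulliMeasure, integral_bernoulliMeasure]
  simp only [smul_eq_mul]

theorem integral_signedEntry (p s : unitInterval) :
    ∫ y, signedEntry y ∂choiceMeasure p s = p * (1 - 2 * s) := by
  rw [integral_choiceMeasure]
  simp only [signedEntry, if_true, Bool.false_eq_true, if_false]
  ring

theorem integral_unsignedEntry (p s : unitInterval) :
    ∫ y, unsignedEntry y ∂choiceMeasure p s = p := by
  rw [integral_choiceMeasure]
  simp only [unsignedEntry, if_true, Bool.false_eq_true, if_false]
  ring

theorem blockExtend_bisection {k : ℕ} (p q : unitInterval) {i j : Fin (2 * k)} (hij : i ≠ j) :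
    blockExtend (bisection k) !![p, q; q, p] (s(i, j) : Sym2 (Fin (2 * k))).inf
      (s(i, j) : Sym2 (Fin (2 * k))).sup = if ((i : ℕ) < k ↔ (j : ℕ) < k) then p else q := by
  have h : ∀ a b : Fin (2 * k), a ≠ b → blockExtend (bisection k) !![p, q; q, p] a b =
      if ((a : ℕ) < k ↔ (b : ℕ) < k) then p else q := by
    intro a b hab
    simp only [blockExtend, Matrix.of_apply, if_neg hab, bisection]
    by_cases ha : (a : ℕ) < k <;> by_cases hb : (b : ℕ) < k <;> simp [ha, hb]
  simp only [Sym2.inf_mk, Sym2.sup_mk]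
  rcases le_total i j with hle | hle
  · rw [inf_eq_left.2 hle, sup_eq_right.2 hle, h i j hij]
  · rw [inf_eq_right.2 hle, sup_eq_left.2 hle, h j i hij.symm]
    simp only [iff_comm]

/-- The sign vector of the bisection. -/
def bisectionSign (k : ℕ) (i : Fin (2 * k)) : ℝ := if (i : ℕ) < k then 1 else -1

theorem bisectionSign_sq (k : ℕ) (i : Fin (2 * k)) : bisectionSign k i ^ 2 = 1 := by
  unfold bisectionSign; split_ifs <;> norm_num

theorem sum_bisectionSign (k : ℕ) : ∑ i, bisectionSign k i = 0 := by
  unfold bisectionSign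
  rw [Fin.sum_univ_eq_sum_range (fun i => if i < k then (1 : ℝ) else -1) (2 * k), two_mul,
    Finset.sum_range_add]
  rw [Finset.sum_congr rfl (g := fun _ => (1 : ℝ)) (fun i hi => if_pos (Finset.mem_range.1 hi)),
    Finset.sum_congr rfl (g := fun _ => (-1 : ℝ)) (s₁ := Finset.range k)
      (f := fun x => if k + x < k then (1 : ℝ) else -1) (fun i _ => if_neg (by omega))]
  simp

/-- The matrix with constant blocks `a + b` inside and `a - b` between the communities. -/
def blockMatrix (k : ℕ) (a b : ℝ) : Matrix (Fin (2 * k)) (Fin (2 * k)) ℝ :=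
  Matrix.of fun i j => a + b * (bisectionSign k i * bisectionSign k j)

theorem sum_blockMatrix_row (k : ℕ) (a b : ℝ) (i : Fin (2 * k)) :
    ∑ j, blockMatrix k a b i j = 2 * k * a := by
  simp only [blockMatrix, Matrix.of_apply]
  rw [Finset.sum_add_distrib, ← Finset.mul_sum, ← Finset.mul_sum, sum_bisectionSign]
  simp

theorem bisectionSign_mul (k : ℕ) (i j : Fin (2 * k)) :
    bisectionSign k i * bisectionSign k j = if ((i : ℕ) < k ↔ (j : ℕ) < k) then 1 else -1 := by
  unfold bisectionSign
  by_cases hi : (i : ℕ) < k <;> by_cases hj : (j : ℕ) < k <;> simp [hi, hj]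

/-- The law of the choices at the pair `e` in the stochastic bisection model. -/
noncomputable def bisectionMeasure (k : ℕ) (p q s : unitInterval) (e : EdgeIndex (Fin (2 * k))) :
    Measure (Bool × Bool) :=
  choiceMeasure (blockExtend (bisection k) !![p, q; q, p] e.1.inf e.1.sup)
    (blockExtend (bisection k) !![s, unitInterval.symm s; unitInterval.symm s, s] e.1.inf e.1.sup)

instance (k : ℕ) (p q s : unitInterval) (e : EdgeIndex (Fin (2 * k))) :
    IsProbabilityMeasure (bisectionMeasure k p q s e) := by
  unfold bisectionMeasure; infer_instance

theorem signedBlock_eq_map (k : ℕ) (p q s : unitInterval) :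
    signedBlock k p q s =
      (Measure.pi (bisectionMeasure k p q s)).map SignedGraph.ofChoices := rfl

/-- The mean matrix has no loops, whereas the block matrix has `a + b` on its diagonal; the
correction has norm at most `|a + b|`. -/
theorem edgeMatrix_eq_blockMatrix_sub {k : ℕ} {x : EdgeIndex (Fin (2 * k)) → ℝ} {a b : ℝ}
    (h : ∀ i j (hij : ¬ (s(i, j) : Sym2 (Fin (2 * k))).IsDiag),
      x ⟨s(i, j), hij⟩ = a + b * (bisectionSign k i * bisectionSign k j)) :
    edgeMatrix x = blockMatrix k a b - (a + b) • (1 : Matrix (Fin (2 * k)) (Fin (2 * k)) ℝ) := by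
  ext i j
  simp only [edgeMatrix, blockMatrix, Matrix.sub_apply, Matrix.of_apply, Matrix.smul_apply,
    Matrix.one_apply, smul_eq_mul]
  split_ifs with hij h2 h2
  · subst h2
    have := bisectionSign_sq k i
    rw [← sq, this]; ring
  · exact absurd (Sym2.mk_isDiag_iff.1 hij) h2
  · exact absurd (Sym2.mk_isDiag_iff.2 h2) hij
  · rw [h i j hij]; ring

theorem mean_signedEntry {k : ℕ} (p q s : unitInterval) (i j : Fin (2 * k))
    (hij : ¬ (s(i, j) : Sym2 (Fin (2 * k))).IsDiag) :
    ∫ y, signedEntry y ∂bisectionMeasure k p q s ⟨s(i, j), hij⟩ =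
      (1 - 2 * s) * ((p - q) / 2) +
        (1 - 2 * s) * ((p + q) / 2) * (bisectionSign k i * bisectionSign k j) := by
  have h : i ≠ j := fun h => hij (Sym2.mk_isDiag_iff.2 h)
  rw [bisectionMeasure, integral_signedEntry, blockExtend_bisection _ _ h,
    blockExtend_bisection _ _ h, bisectionSign_mul]
  split_ifs
  · ring
  · rw [unitInterval.coe_symm_eq]; ring

theorem mean_unsignedEntry {k : ℕ} (p q s : unitInterval) (i j : Fin (2 * k))
    (hij : ¬ (s(i, j) : Sym2 (Fin (2 * k))).IsDiag) :
    ∫ y, unsignedEntry y ∂bisectionMeasure k p q s ⟨s(i, j), hij⟩ =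
      ((p : ℝ) + q) / 2 + ((p : ℝ) - q) / 2 * (bisectionSign k i * bisectionSign k j) := by
  have h : i ≠ j := fun h => hij (Sym2.mk_isDiag_iff.2 h)
  rw [bisectionMeasure, integral_unsignedEntry, blockExtend_bisection _ _ h, bisectionSign_mul]
  split_ifs <;> ring

theorem integral_unsignedEntry_le {k : ℕ} {p q s : unitInterval} (hqp : q ≤ p)
    (e : EdgeIndex (Fin (2 * k))) : ∫ y, unsignedEntry y ∂bisectionMeasure k p q s e ≤ p := by
  obtain ⟨e, he⟩ := e
  induction e with
  | _ i j =>
    have h : i ≠ j := fun h => he (Sym2.mk_isDiag_iff.2 h)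
    rw [bisectionMeasure, integral_unsignedEntry, blockExtend_bisection _ _ h]
    split_ifs
    · exact le_rfl
    · exact hqp

/-- Concentration of the random matrix with entries `h (ω e)` around its blockwise mean. -/
theorem exists_norm_sub_blockMatrix_tail (c₀ : ℝ) : ∃ K : ℝ, 0 < K ∧
    ∀ (k : ℕ), 2 ≤ k → ∀ p q s : unitInterval, q ≤ p →
    ((2 * k : ℕ) : ℝ) * p ≤ c₀ * Real.log (2 * k : ℕ) →
    ∀ (h : Bool × Bool → ℝ), (∀ y, h y ^ 2 = unsignedEntry y) → ∀ a b : ℝ, |a + b| ≤ 1 →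
    (∀ i j (hij : ¬ (s(i, j) : Sym2 (Fin (2 * k))).IsDiag),
      ∫ y, h y ∂bisectionMeasure k p q s ⟨s(i, j), hij⟩ =
        a + b * (bisectionSign k i * bisectionSign k j)) →
    (Measure.pi (bisectionMeasure k p q s)).real
      {ω | 2 * (K * Real.sqrt (Real.log (2 * k : ℕ))) + 1 <
        ‖edgeMatrix (fun e => h (ω e)) - blockMatrix k a b‖} ≤ 2 / ((2 * k : ℕ) : ℝ) ^ 2 := by
  obtain ⟨K, hK, htail⟩ := exists_norm_edgeMatrix_tail c₀
  refine ⟨K, hK, fun k hk p q s hqp hp h hh a b hab hmean => ?_⟩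
  set μ := bisectionMeasure k p q s
  have hh1 : ∀ y, |h y| ≤ 1 := fun y => by
    rw [← sq_le_one_iff_abs_le_one, hh, unsignedEntry]
    split_ifs <;> norm_num
  have hm1 : ∀ e, |∫ y, h y ∂μ e| ≤ 1 := fun e => by
    have := norm_integral_le_of_norm_le_const (μ := μ e) (f := h) (C := 1)
      (Filter.Eventually.of_forall hh1)
    simpa using this
  -- Centring may double the range of an entry; halving restores the bound `1`. As `h²` is the edge
  -- indicator, the variance is at most `p`.
  have := htail (2 * k) (by omega) μ (fun e y => (h y - ∫ y, h y ∂μ e) / 2)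
    (fun e => measurable_of_finite _) (fun e y => by
      rw [abs_div, abs_two, div_le_one (by norm_num)]
      exact (abs_sub _ _).trans (by linarith [hh1 y, hm1 e]))
    (fun e => by
      rw [integral_div, integral_sub Integrable.of_finite (integrable_const _)]
      simp)
    p p.2.1 p.2.2 (fun e => by
      refine le_trans ?_ (integral_unsignedEntry_le (s := s) hqp e)
      have e1 : ∫ y, ((h y - ∫ y, h y ∂μ e) / 2) ^ 2 ∂μ e =
          (∫ y, unsignedEntry y ∂μ e - (∫ y, h y ∂μ e) ^ 2) / 4 := by
        have e2 : ∀ y, ((h y - ∫ y, h y ∂μ e) / 2) ^ 2 =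
            (unsignedEntry y - 2 * (∫ y, h y ∂μ e) * h y + (∫ y, h y ∂μ e) ^ 2) / 4 := fun y => by
          rw [← hh]; ring
        simp_rw [e2]
        rw [integral_div, integral_add Integrable.of_finite (integrable_const _),
          integral_sub Integrable.of_finite Integrable.of_finite, integral_const_mul]
        simp
        ring
      have e3 : 0 ≤ ∫ y, unsignedEntry y ∂μ e := integral_nonneg fun y => by
        unfold unsignedEntry; positivity
      rw [e1]
      nlinarith [sq_nonneg (∫ y, h y ∂μ e)]) hp
  refine le_trans (measureReal_mono ?_) this
  intro ω hω
  simp only [Set.mem_ofPred_eq] at hω ⊢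
  set f : EdgeIndex (Fin (2 * k)) → ℝ := fun e => (h (ω e) - ∫ y, h y ∂μ e) / 2
  have e1 : edgeMatrix (fun e => h (ω e)) - blockMatrix k a b =
      (2 : ℝ) • edgeMatrix f - (a + b) • (1 : Matrix (Fin (2 * k)) (Fin (2 * k)) ℝ) := by
    have e2 := edgeMatrix_eq_blockMatrix_sub (x := fun e => ∫ y, h y ∂μ e) hmean
    have e3 : edgeMatrix (fun e => h (ω e)) =
        (2 : ℝ) • edgeMatrix f + edgeMatrix (fun e => ∫ y, h y ∂μ e) := by
      ext i j
      simp only [edgeMatrix, Matrix.of_apply, Matrix.add_apply, Matrix.smul_apply, smul_eq_mul, f]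
      split_ifs <;> ring
    rw [e3, e2]
    abel
  rw [e1] at hω
  have e4 : ‖(1 : Matrix (Fin (2 * k)) (Fin (2 * k)) ℝ)‖ ≤ 1 := by
    rw [← Matrix.diagonal_one, Matrix.l2_opNorm_diagonal]
    exact (pi_norm_le_iff_of_nonneg zero_le_one).2 fun i => by simp
  have e5 := norm_sub_le ((2 : ℝ) • edgeMatrix f) ((a + b) • (1 : Matrix (Fin (2 * k)) (Fin (2 * k)) ℝ))
  rw [norm_smul, norm_smul, Real.norm_eq_abs, Real.norm_eq_abs, abs_two] at e5
  have e6 : |a + b| * ‖(1 : Matrix (Fin (2 * k)) (Fin (2 * k)) ℝ)‖ ≤ 1 :=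
    mul_le_one₀ hab (norm_nonneg _) e4
  linarith

/-- A lower tail bound of Chernoff type for the degrees. -/
theorem degree_lower_tail {k : ℕ} (p q s : unitInterval) (i : Fin (2 * k)) (c : ℝ) :
    (Measure.pi (bisectionMeasure k p q s)).real
      {ω | ((SignedGraph.ofChoices ω).degree i : ℝ) < c} ≤
      Real.exp (2 * c - (1 - Real.exp (-2)) * (k * (p + q) - p)) := by
  set μ := bisectionMeasure k p q s
  have hmean : ∑ e : EdgeIndex (Fin (2 * k)),
      (if i ∈ (e : Sym2 (Fin (2 * k))) then ∫ y, unsignedEntry y ∂μ e else 0) =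
      k * (p + q) - p := by
    rw [← sum_edgeMatrix_row (fun e => ∫ y, unsignedEntry y ∂μ e),
      edgeMatrix_eq_blockMatrix_sub (mean_unsignedEntry p q s)]
    simp only [Matrix.sub_apply, Finset.sum_sub_distrib, sum_blockMatrix_row, Matrix.smul_apply,
      Matrix.one_apply, smul_eq_mul]
    simp
    ring
  have hexp : ∀ ω : EdgeIndex (Fin (2 * k)) → Bool × Bool,
      Real.exp (-2 * ((SignedGraph.ofChoices ω).degree i : ℝ)) =
      ∏ e : EdgeIndex (Fin (2 * k)),
        Real.exp (-2 * if i ∈ (e : Sym2 (Fin (2 * k))) then unsignedEntry (ω e) else 0) := by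
    intro ω
    rw [SignedGraph.degree_ofChoices, sum_edgeMatrix_row, Finset.mul_sum, Real.exp_sum]
  have hfac : ∀ e : EdgeIndex (Fin (2 * k)),
      ∫ y, Real.exp (-2 * if i ∈ (e : Sym2 (Fin (2 * k))) then unsignedEntry y else 0) ∂μ e ≤
      Real.exp (-((1 - Real.exp (-2)) *
        if i ∈ (e : Sym2 (Fin (2 * k))) then ∫ y, unsignedEntry y ∂μ e else 0)) := by
    intro e
    split_ifs
    -- On the values `0` and `1` the exponential is affine, so its mean is explicit; then use `1 - x
    -- ≤ exp (-x)`.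
    · have e1 : ∀ y, Real.exp (-2 * unsignedEntry y) =
          1 - (1 - Real.exp (-2)) * unsignedEntry y := fun y => by
        unfold unsignedEntry; split_ifs <;> simp
      simp_rw [e1]
      rw [integral_sub (integrable_const _) Integrable.of_finite, integral_const_mul]
      simp only [integral_const, probReal_univ, smul_eq_mul, one_mul]
      linarith [Real.add_one_le_exp (-((1 - Real.exp (-2)) * ∫ y, unsignedEntry y ∂μ e))]
    · simp
  have hint : ∫ ω, Real.exp (-2 * ((SignedGraph.ofChoices ω).degree i : ℝ)) ∂Measure.pi μ ≤
      Real.exp (-((1 - Real.exp (-2)) * (k * (p + q) - p))) := by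
    simp_rw [hexp]
    rw [integral_fintype_prod_eq_prod (fun (e : EdgeIndex (Fin (2 * k))) y =>
      Real.exp (-2 * if i ∈ (e : Sym2 (Fin (2 * k))) then unsignedEntry y else 0))]
    refine (Finset.prod_le_prod (fun e _ => integral_nonneg fun y => (Real.exp_pos _).le)
      fun e _ => hfac e).trans (le_of_eq ?_)
    rw [← Real.exp_sum, Finset.sum_neg_distrib, ← Finset.mul_sum, hmean]
  have hmarkov := mul_meas_ge_le_integral_of_nonneg (μ := Measure.pi μ)
    (f := fun ω => Real.exp (-2 * ((SignedGraph.ofChoices ω).degree i : ℝ)))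
    (Filter.Eventually.of_forall fun ω => (Real.exp_pos _).le) Integrable.of_finite
    (Real.exp (-2 * c))
  have hsub : {ω : EdgeIndex (Fin (2 * k)) → Bool × Bool |
      ((SignedGraph.ofChoices ω).degree i : ℝ) < c} ⊆
      {ω | Real.exp (-2 * c) ≤ Real.exp (-2 * ((SignedGraph.ofChoices ω).degree i : ℝ))} := by
    intro ω hω
    simp only [Set.mem_ofPred_eq, Real.exp_le_exp] at hω ⊢
    linarith
  have h1 := mul_le_mul_of_nonneg_left (measureReal_mono (μ := Measure.pi μ) hsub)
    (Real.exp_pos (-2 * c)).le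
  have h2 := (h1.trans hmarkov).trans hint
  refine le_of_mul_le_mul_left (h2.trans (le_of_eq ?_)) (Real.exp_pos (-2 * c))
  rw [← Real.exp_add]
  congr 1
  ring

/-- The degree deviations are the entries of the noise matrix applied to the all-ones vector, whose
squared norm is `2k`. -/
theorem sum_degree_sub_sq_le {k : ℕ} (ω : EdgeIndex (Fin (2 * k)) → Bool × Bool) {a b η : ℝ}
    (hη : ‖edgeMatrix (fun e => unsignedEntry (ω e)) - blockMatrix k a b‖ ≤ η) :
    ∑ i, (((SignedGraph.ofChoices ω).degree i : ℝ) - 2 * k * a) ^ 2 ≤ η ^ 2 * (2 * k : ℕ) := by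
  set A := edgeMatrix (fun e => unsignedEntry (ω e)) - blockMatrix k a b with hA
  have h := (Matrix.toEuclideanCLM (𝕜 := ℝ) A).le_opNorm (WithLp.toLp 2 fun _ => 1)
  rw [Matrix.l2_opNorm_toEuclideanCLM] at h
  have h2 := pow_le_pow_left₀ (norm_nonneg _) h 2
  rw [mul_pow, EuclideanSpace.norm_sq_eq, EuclideanSpace.norm_sq_eq] at h2
  have h3 : ∀ i, (Matrix.toEuclideanCLM (𝕜 := ℝ) A (WithLp.toLp 2 fun _ => 1)).ofLp i =
      ((SignedGraph.ofChoices ω).degree i : ℝ) - 2 * k * a := fun i => by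
    rw [SignedGraph.degree_ofChoices, ← sum_blockMatrix_row k a b i, ← Finset.sum_sub_distrib]
    simp [Matrix.mulVec, dotProduct, hA]
  simp only [h3, Real.norm_eq_abs, sq_abs] at h2
  refine h2.trans ?_
  have h4 : ‖A‖ ^ 2 ≤ η ^ 2 := pow_le_pow_left₀ (norm_nonneg _) hη 2
  simp
  gcongr

end Model

/-! ### Assembly of the eigenvalue estimates. -/

open scoped Matrix.Norms.L2Operator in
/-- On the event that both adjacency matrices are concentrated and no degree is too small, the
eigenvalues are those of the block model up to a small error. -/
theorem lapEigenvalue_ofChoices_of_concentration {k : ℕ} (hk : 0 < k) {p q s η c : ℝ}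
    (hs₀ : 0 ≤ s) (hs₁ : s ≤ 1 / 2) (hq : 0 < q) (hqp : q ≤ p) (hη : 0 ≤ η) (hc : 0 < c)
    (hcd : c ≤ k * (p + q)) (ω : EdgeIndex (Fin (2 * k)) → Bool × Bool)
    (h1 : ‖edgeMatrix (fun e => signedEntry (ω e)) -
      blockMatrix k ((1 - 2 * s) * ((p - q) / 2)) ((1 - 2 * s) * ((p + q) / 2))‖ ≤ η)
    (h2 : ‖edgeMatrix (fun e => unsignedEntry (ω e)) -
      blockMatrix k ((p + q) / 2) ((p - q) / 2)‖ ≤ η)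
    (h3 : ∀ i, c ≤ ((SignedGraph.ofChoices ω).degree i : ℝ)) :
    (∀ ℓ : Fin (2 * k), (ℓ : ℕ) = 0 →
      |(SignedGraph.ofChoices ω).lapEigenvalue ℓ - 2 * s| ≤ 5 * η / c) ∧
    (∀ ℓ : Fin (2 * k), (ℓ : ℕ) = 1 →
      |(SignedGraph.ofChoices ω).lapEigenvalue ℓ - (1 - (1 - 2 * s) * ((p - q) / (p + q)))|
        ≤ 5 * η / c) ∧
    (∀ ℓ : Fin (2 * k), 2 ≤ (ℓ : ℕ) →
      |(SignedGraph.ofChoices ω).lapEigenvalue ℓ - 1| ≤ 5 * η / c) := by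
  have hk0 : (0 : ℝ) < k := by exact_mod_cast hk
  have hpq : 0 < p + q := by linarith
  have hs2 : 0 ≤ 1 - 2 * s := by linarith
  have hdeg := sum_degree_sub_sq_le ω h2
  have e1 : 2 * (k : ℝ) * ((p + q) / 2) = k * (p + q) := by ring
  rw [e1] at hdeg
  rw [← SignedGraph.adjacency_ofChoices] at h1
  have key := (SignedGraph.ofChoices ω).lapEigenvalue_of_near_blocks (bisectionSign_sq k)
    (sum_bisectionSign k) (by omega) (mul_nonneg hs2 (by linarith))
    (mul_le_mul_of_nonneg_left (by linarith) hs2) hc hcd hη h3 hdeg h1 (by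
      push_cast
      have : (1 - 2 * s) * p ≤ p + q := by nlinarith
      nlinarith)
  have e2 : (1 - 2 * s) * ((p + q) / 2) * ((2 * k : ℕ) : ℝ) / (k * (p + q)) = 1 - 2 * s := by
    push_cast; field_simp
  have e3 : (1 - 2 * s) * ((p - q) / 2) * ((2 * k : ℕ) : ℝ) / (k * (p + q)) =
      (1 - 2 * s) * ((p - q) / (p + q)) := by
    push_cast; field_simp
  rw [e2, e3, sub_sub_cancel] at key
  exact key

theorem exp_neg_two_le : Real.exp (-2) ≤ 137 / 1000 := by
  have h1 : (2.7182818283 : ℝ) ^ 2 ≤ Real.exp 1 ^ 2 :=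
    pow_le_pow_left₀ (by norm_num) Real.exp_one_gt_d9.le 2
  rw [← Real.exp_nat_mul] at h1
  norm_num at h1
  rw [Real.exp_neg, inv_le_comm₀ (Real.exp_pos _) (by norm_num)]
  exact le_trans (by norm_num) h1

/-- The left side is `2 k^(-9/100)`. Since `2k ≤ k²`, the right side is at least `2 k^(-8/100)`. -/
theorem two_mul_exp_neg_log_le {k : ℕ} (hk : 2 ≤ k) :
    (2 * k : ℕ) * Real.exp (-(109 / 100) * Real.log k) ≤
      2 * ((2 * k : ℕ) : ℝ) ^ (-(1 / 25) : ℝ) := by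
  have hk0 : (0 : ℝ) < k := by exact_mod_cast (by omega : 0 < k)
  have hk2 : (2 : ℝ) ≤ k := by exact_mod_cast hk
  have hl : Real.log 2 ≤ Real.log k := Real.log_le_log (by norm_num) hk2
  rw [Real.rpow_def_of_pos (by positivity)]
  push_cast
  rw [Real.log_mul (by norm_num) hk0.ne', mul_assoc]
  gcongr
  nth_rewrite 1 [← Real.exp_log hk0]
  rw [← Real.exp_add, Real.exp_le_exp]
  have : 0 ≤ Real.log 2 := Real.log_nonneg (by norm_num)
  linarith

theorem two_div_sq_le {n : ℕ} (hn : 1 ≤ n) :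
    2 / (n : ℝ) ^ 2 ≤ 2 * (n : ℝ) ^ (-(1 / 25) : ℝ) := by
  have hn1 : (1 : ℝ) ≤ n := by exact_mod_cast hn
  rw [div_eq_mul_inv, ← Real.rpow_natCast, ← Real.rpow_neg (by positivity)]
  gcongr 2 * ?_
  exact Real.rpow_le_rpow_of_exponent_le hn1 (by norm_num)

open scoped Matrix.Norms.L2Operator in
theorem corollary4p11 (γ₁ γ₂ : ℝ) (hγ₂ : 1 < γ₂) (hγ₁ : γ₂ < γ₁)
    (s : unitInterval) (hs₀ : 0 < (s : ℝ)) (hs₁ : (s : ℝ) < 1 / 2) :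
    ∃ C₁ C₂ C₃ : ℝ, 0 < C₁ ∧ 0 < C₂ ∧ 0 < C₃ ∧
      ∃ ε : ℕ → ℝ, Filter.Tendsto ε Filter.atTop (nhds 0) ∧
        ∀ (k : ℕ) (hk : 2 ≤ k) (p q : unitInterval),
          (p : ℝ) = γ₁ * Real.log k / k → (q : ℝ) = γ₂ * Real.log k / k →
          1 - C₁ * ((2 * k : ℕ) : ℝ) ^ (-C₂) ≤
            (signedBlock k p q s).real
              {G | |G.lapEigenvalue ⟨0, by omega⟩ - 2 * (s : ℝ)|
                      ≤ C₃ * Real.log k ^ (-(1 / 2) : ℝ) ∧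
                   |G.lapEigenvalue ⟨1, by omega⟩
                      - (1 - (1 - 2 * (s : ℝ)) * ((γ₁ - γ₂) / (γ₁ + γ₂)))| ≤ ε k ∧
                   ∀ ℓ : Fin (2 * k), 2 ≤ (ℓ : ℕ) → |G.lapEigenvalue ℓ - 1| ≤ ε k} := by
  obtain ⟨K, hK, htail⟩ := exists_norm_sub_blockMatrix_tail (2 * γ₁)
  set C₃ : ℝ := 50 * (4 * K + 2) with hC₃
  -- Each of three bad events has probability at most `2 n^(-1/25)`. The constant `C₃` is `5 η / c`
  -- with `η = (4K + 2) √(log k)` and `c = log k / 10`, up to the factor `(log k)^(-1/2)`.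
  refine ⟨6, 1 / 25, C₃, by norm_num, by norm_num, by positivity,
    fun k => C₃ * Real.log k ^ (-(1 / 2) : ℝ), ?_, fun k hk p q hp hq => ?_⟩
  · have := ((tendsto_rpow_neg_atTop (by norm_num : (0 : ℝ) < 1 / 2)).comp
      (Real.tendsto_log_atTop.comp tendsto_natCast_atTop_atTop)).const_mul C₃
    simpa using this
  have hk0 : (0 : ℝ) < k := by exact_mod_cast (by omega : 0 < k)
  have hk2 : (2 : ℝ) ≤ k := by exact_mod_cast hk
  set lk := Real.log k with hlk
  have hl2 : 1 / 2 ≤ lk := by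
    have : Real.log 2 ≤ lk := Real.log_le_log (by norm_num) hk2
    linarith [Real.log_two_gt_d9]
  have hl0 : 0 < lk := by linarith
  have hln : Real.log (2 * k : ℕ) ≤ 2 * lk := by
    push_cast
    rw [Real.log_mul (by norm_num) hk0.ne']
    linarith [Real.log_le_log (by norm_num) hk2]
  have hln' : lk ≤ Real.log (2 * k : ℕ) :=
    Real.log_le_log hk0 (by push_cast; linarith)
  have hkp : k * (p : ℝ) = γ₁ * lk := by rw [hp]; field_simp
  have hkq : k * (q : ℝ) = γ₂ * lk := by rw [hq]; field_simp
  have hq0 : 0 < (q : ℝ) := by rw [hq]; positivity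
  have hqp : (q : ℝ) ≤ p := by rw [hp, hq]; gcongr
  set S := Real.sqrt lk with hS
  have hS0 : 0 < S := Real.sqrt_pos.2 hl0
  have hS2 : S ^ 2 = lk := Real.sq_sqrt hl0.le
  set η := (4 * K + 2) * S with hη
  have hbound : 2 * (K * Real.sqrt (Real.log (2 * k : ℕ))) + 1 ≤ η := by
    have h1 : Real.sqrt (Real.log (2 * k : ℕ)) ≤ 2 * S := by
      rw [Real.sqrt_le_left (by positivity)]
      nlinarith
    have h2 : 1 ≤ 2 * S := by nlinarith
    nlinarith
  have herr : 5 * η / (lk / 10) = C₃ * lk ^ (-(1 / 2) : ℝ) := by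
    rw [Real.rpow_neg hl0.le, ← Real.sqrt_eq_rpow, ← hS, hη, hC₃, ← hS2]
    field_simp
    ring
  have hratio : ((p : ℝ) - q) / (p + q) = (γ₁ - γ₂) / (γ₁ + γ₂) := by
    rw [← mul_div_mul_left _ _ hk0.ne', mul_sub, mul_add, hkp, hkq, ← sub_mul, ← add_mul,
      mul_div_mul_right _ _ hl0.ne']
  set P := Measure.pi (bisectionMeasure k p q s) with hP
  have hnp : ((2 * k : ℕ) : ℝ) * p ≤ 2 * γ₁ * Real.log (2 * k : ℕ) := by
    push_cast
    rw [mul_assoc, hkp]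
    have h0 : 0 ≤ 2 * γ₁ := by linarith
    have h1 := mul_le_mul_of_nonneg_left hln' h0
    push_cast at h1
    linarith
  have hs2 : 0 ≤ 1 - 2 * (s : ℝ) := by linarith
  set B₁ := {ω : EdgeIndex (Fin (2 * k)) → Bool × Bool |
    2 * (K * Real.sqrt (Real.log (2 * k : ℕ))) + 1 < ‖edgeMatrix (fun e => signedEntry (ω e)) -
      blockMatrix k ((1 - 2 * s) * ((p - q) / 2)) ((1 - 2 * s) * ((p + q) / 2))‖} with hB₁
  set B₂ := {ω : EdgeIndex (Fin (2 * k)) → Bool × Bool |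
    2 * (K * Real.sqrt (Real.log (2 * k : ℕ))) + 1 < ‖edgeMatrix (fun e => unsignedEntry (ω e)) -
      blockMatrix k (((p : ℝ) + q) / 2) (((p : ℝ) - q) / 2)‖} with hB₂
  set B₃ := fun i => {ω : EdgeIndex (Fin (2 * k)) → Bool × Bool |
    ((SignedGraph.ofChoices ω).degree i : ℝ) < lk / 10} with hB₃
  have hP₁ : P.real B₁ ≤ 2 * ((2 * k : ℕ) : ℝ) ^ (-(1 / 25) : ℝ) := by
    refine (htail k hk p q s hqp hnp signedEntry (fun y => ?_) _ _ ?_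
      (mean_signedEntry p q s)).trans (two_div_sq_le (by omega))
    · unfold signedEntry unsignedEntry
      split_ifs <;> norm_num
    · have e : (1 - 2 * (s : ℝ)) * (((p : ℝ) - q) / 2) + (1 - 2 * s) * ((p + q) / 2) =
          (1 - 2 * s) * p := by ring
      rw [e, abs_of_nonneg (mul_nonneg hs2 p.2.1)]
      exact mul_le_one₀ (by linarith) p.2.1 p.2.2
  have hP₂ : P.real B₂ ≤ 2 * ((2 * k : ℕ) : ℝ) ^ (-(1 / 25) : ℝ) := by
    refine (htail k hk p q s hqp hnp unsignedEntry (fun y => ?_) _ _ ?_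
      (mean_unsignedEntry p q s)).trans (two_div_sq_le (by omega))
    · unfold unsignedEntry
      split_ifs <;> norm_num
    · have e : ((p : ℝ) + q) / 2 + (p - q) / 2 = p := by ring
      rw [e, abs_of_nonneg p.2.1]
      exact p.2.2
  have hP₃ : P.real (⋃ i, B₃ i) ≤ 2 * ((2 * k : ℕ) : ℝ) ^ (-(1 / 25) : ℝ) := by
    refine le_trans ?_ (two_mul_exp_neg_log_le hk)
    have h1 : ∀ i, P.real (B₃ i) ≤ Real.exp (-(109 / 100) * lk) := fun i => by
      refine (degree_lower_tail p q s i (lk / 10)).trans (Real.exp_le_exp.2 ?_)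
      -- The mean degree keeps at least half of `k p` because `k ≥ 2`, and `γ₁, γ₂ > 1`. The
      -- exponent is then at most `(2/10 - 0.863 · 3/2) log k`, below `-1.09 log k`, so the union
      -- bound over `2k` vertices succeeds.
      have h2 : 3 / 2 * lk ≤ k * ((p : ℝ) + q) - p := by
        have h3 : 2 * (p : ℝ) ≤ k * p := mul_le_mul_of_nonneg_right hk2 p.2.1
        nlinarith
      have h4 := mul_le_mul (sub_le_sub_left exp_neg_two_le 1) h2 (by positivity)
        (by linarith [exp_neg_two_le])
      nlinarith
    refine (measureReal_iUnion_fintype_le _).trans ((Finset.sum_le_sum fun i _ => h1 i).trans ?_)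
    rw [Finset.sum_const, Finset.card_univ, Fintype.card_fin, nsmul_eq_mul]
  have hsub : (B₁ ∪ B₂ ∪ ⋃ i, B₃ i)ᶜ ⊆ SignedGraph.ofChoices ⁻¹'
      {G | |G.lapEigenvalue ⟨0, by omega⟩ - 2 * (s : ℝ)| ≤ C₃ * lk ^ (-(1 / 2) : ℝ) ∧
        |G.lapEigenvalue ⟨1, by omega⟩
          - (1 - (1 - 2 * (s : ℝ)) * ((γ₁ - γ₂) / (γ₁ + γ₂)))| ≤ C₃ * lk ^ (-(1 / 2) : ℝ) ∧
        ∀ ℓ : Fin (2 * k), 2 ≤ (ℓ : ℕ) → |G.lapEigenvalue ℓ - 1| ≤ C₃ * lk ^ (-(1 / 2) : ℝ)} := by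
    intro ω hω
    simp only [Set.mem_compl_iff, Set.mem_union, Set.mem_iUnion, not_or, not_exists, hB₁, hB₂, hB₃,
      Set.mem_ofPred_eq, not_lt] at hω
    have key := lapEigenvalue_ofChoices_of_concentration (by omega) hs₀.le hs₁.le hq0 hqp
      (by positivity : 0 ≤ η) (by positivity : 0 < lk / 10) (by rw [mul_add, hkp, hkq]; nlinarith) ω
      (hω.1.1.trans hbound) (hω.1.2.trans hbound) hω.2
    rw [herr, hratio] at key
    exact ⟨key.1 _ rfl, key.2.1 _ rfl, key.2.2⟩
  rw [signedBlock_eq_map, map_measureReal_apply (measurable_of_finite _)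
    MeasurableSpace.measurableSet_top]
  refine le_trans ?_ (measureReal_mono hsub)
  rw [probReal_compl_eq_one_sub (Set.toFinite _).measurableSet]
  have h1 := measureReal_union_le (μ := P) (B₁ ∪ B₂) (⋃ i, B₃ i)
  have h2 := measureReal_union_le (μ := P) B₁ B₂
  linarith
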